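/- Let $R=\mathbb{Z}[\alpha_1,\alpha_2]$ and $A=R[X]/((X-\alpha_1)(X-\alpha_2))$, with comultiplication $\Delta\colon A\to A\otimes_R A$ the $A$-linear map with $\Delta(1)=(X-\alpha_1)\otimes 1+1\otimes(X-\alpha_2)$, and put $X_*=(X-\alpha_1)+(X-\alpha_2)\in A$. For an oriented planar link diagram $K$ let $C_\alpha(K)$ be the Khovanov cube-of-resolutions complex built from $A$ (one tensor factor $A$ for each circle of a resolution, multiplication for merging circles, $\Delta$ for splitting a circle, with the usual signs), and let $\alpha(K)$ be its homology. For a point $e$ of $K$ (not a crossing) let $(X_*)_e\colon C_\alpha(K)\to C_\alpha(K)$ be multiplication by $X_*$ in the tensor factor of the circle through $e$. Let $L$ be a link diagram obtained from $K$ by an oriented saddle that increases the number of link components. Let $f\colon C_\alpha(K)\to C_\alpha(L)$ be the map induced by this saddle (multiplication or $\Delta$ in each resolution), and $f'\colon C_\alpha(L)\to C_\alpha(K)$ the map induced by the reverse saddle. Let $e$ be any point on the component of $K$ on which the saddle is performed (so any point of $K$, if $K$ is a knot diagram). Then $C_\alpha(K)$ and $C_\alpha(L)$ are complexes, $f$,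 $f'$ and $(X_*)_e$ are chain maps, and there is a sign $\varepsilon\in\{1,-1\}$ such that $f'\circ f$ is chain homotopic to $\varepsilon\,(X_*)_e$; in particular $f'\circ f$ and $\varepsilon\,(X_*)_e$ induce the same map on $\alpha(K)$. -/

import Mathlib

open scoped TensorProduct

noncomputable section

namespace AlphaHomology

/-! ### The Frobenius algebra -/

/-- The ground ring `ℤ[α₁, α₂]`. -/
def R : Type := MvPolynomial (Fin 2) ℤ

instance : CommRing R := inferInstanceAs (CommRing (MvPolynomial (Fin 2) ℤ))

/-- The variable `α₁`. -/
def α₁ : R := (MvPolynomial.X 0 : MvPolynomial (Fin 2) ℤ)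

/-- The variable `α₂`. -/
def α₂ : R := (MvPolynomial.X 1 : MvPolynomial (Fin 2) ℤ)

/-- The polynomial `(X - α₁)(X - α₂)`. -/
def relPoly : Polynomial R :=
  (Polynomial.X - Polynomial.C α₁) * (Polynomial.X - Polynomial.C α₂)

/-- The algebra `A = R[X] / ((X - α₁)(X - α₂))`. -/
def A : Type := AdjoinRoot relPoly

instance : CommRing A := inferInstanceAs (CommRing (AdjoinRoot relPoly))

instance : Algebra R A := inferInstanceAs (Algebra R (AdjoinRoot relPoly))

/-- The class of `X` in `A`. -/
def X : A := AdjoinRoot.root relPoly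

/-- The shifted dot `X - α₁`. -/
def dot₁ : A := X - algebraMap R A α₁

/-- The shifted dot `X - α₂`. -/
def dot₂ : A := X - algebraMap R A α₂

/-- The element `X_* = (X - α₁) + (X - α₂)`. -/
def Xstar : A := dot₁ + dot₂

/-- The comultiplication `Δ : A → A ⊗ A`, the map of `A`-modules with
`Δ(1) = (X - α₁) ⊗ 1 + 1 ⊗ (X - α₂)`. -/
def comul : A →ₗ[R] A ⊗[R] A :=
  LinearMap.mulLeft R (dot₁ ⊗ₜ[R] (1 : A) + (1 : A) ⊗ₜ[R] dot₂) ∘ₗ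
    (Algebra.TensorProduct.includeLeft : A →ₐ[R] A ⊗[R] A).toLinearMap

lemma dot₁_mul_dot₂ : dot₁ * dot₂ = 0 := by
  have h := AdjoinRoot.eval₂_root relPoly
  rw [relPoly, Polynomial.eval₂_mul, Polynomial.eval₂_sub, Polynomial.eval₂_sub,
    Polynomial.eval₂_X, Polynomial.eval₂_C, Polynomial.eval₂_C] at h
  exact h

lemma comul_one : comul 1 = dot₁ ⊗ₜ[R] (1 : A) + (1 : A) ⊗ₜ[R] dot₂ := by
  simp [comul, ← Algebra.TensorProduct.one_def]

lemma comul_dot₂ : comul dot₂ = dot₂ ⊗ₜ[R] dot₂ := by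
  simp [comul, add_mul, dot₁_mul_dot₂]

lemma comul_one' : comul 1 = dot₂ ⊗ₜ[R] (1 : A) + (1 : A) ⊗ₜ[R] dot₁ := by
  have h : ∀ r : R, (algebraMap R A r) ⊗ₜ[R] (1 : A) = (1 : A) ⊗ₜ[R] (algebraMap R A r) := by
    intro r
    rw [Algebra.algebraMap_eq_smul_one, TensorProduct.smul_tmul]
  rw [comul_one, dot₁, dot₂, TensorProduct.sub_tmul, TensorProduct.tmul_sub,
    TensorProduct.sub_tmul, TensorProduct.tmul_sub, h, h]
  abel

lemma comul_dot₁ : comul dot₁ = dot₁ ⊗ₜ[R] dot₁ := by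
  have h : comul dot₁ = comul 1 * (dot₁ ⊗ₜ[R] (1 : A)) := by simp [comul, ← Algebra.TensorProduct.one_def]
  rw [h, comul_one']
  simp [add_mul, mul_comm dot₂, dot₁_mul_dot₂]

/-! ### Tensor powers of `A` over the circles of a planar resolution, and saddle maps -/

section Circles

variable {E : Type}

/-- The circles of a resolved diagram with set of edges `E`, where `r` says which edges are joined
at their ends, are the classes of the equivalence relation generated by `r`.  This is the tensor
product over `R` of one copy of `A` for each circle. -/
def CircleAlg (r : E → E → Prop) : Type := ⨂[R] _ : Quot r, A

instance (r : E → E → Prop) : CommRing (CircleAlg r) :=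
  inferInstanceAs (CommRing (⨂[R] _ : Quot r, A))

instance (r : E → E → Prop) : Algebra R (CircleAlg r) :=
  inferInstanceAs (Algebra R (⨂[R] _ : Quot r, A))

open Classical in
/-- The inclusion of `A` as the tensor factor of the circle through the edge `e`. -/
def factor (r : E → E → Prop) (e : E) : A →ₐ[R] CircleAlg r :=
  PiTensorProduct.singleAlgHom (A := fun _ : Quot r => A) (Quot.mk r e)

/-- `A ⊗ A` placed on the factors of the circles through `i` and through `k`. -/
def factor₂ (r : E → E → Prop) (i k : E) : A ⊗[R] A →ₐ[R] CircleAlg r :=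
  Algebra.TensorProduct.lift (factor r i) (factor r k) (fun _ _ => Commute.all _ _)

variable [Finite E]

open Classical in
/-- The map of tensor powers for a saddle which turns the circles of `r` into the circles of `r'`;
before and after the saddle, one of the two local strands belongs to the edge `i` and the other
to the edge `k`.

If the two strands lie on one circle of `r`, the factor of that circle is sent by `Δ` to the factors
of the two circles of `r'` through `i` and `k`.  Otherwise the factors of the two circles are both
sent into the factor of the merged circle and multiplied there.  All other circles
are unchanged; a circle is followed along any one of its edges. -/
def saddleMap (r r' : E → E → Prop) (i k : E) : CircleAlg r →ₗ[R] CircleAlg r' :=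
  haveI : Fintype (Quot r) := Fintype.ofFinite _
  PiTensorProduct.lift
    ((MultilinearMap.mkPiAlgebra R (Quot r) (CircleAlg r')).compLinearMap fun C =>
      if Quot.mk r i = Quot.mk r k ∧ C = Quot.mk r i then
        (factor₂ r' i k).toLinearMap ∘ₗ comul
      else
        (factor r' C.out).toLinearMap)

end Circles

/-! ### Oriented link diagrams -/

/-- The strands at the vertices of a diagram with `n` crossings and `m` marked points: the
over-strand `(c, true)` and the under-strand `(c, false)` at each crossing `c`, and one strand
at each marked point. -/
abbrev Strand (n m : ℕ) : Type := (Fin n × Bool) ⊕ Fin m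

/-- An oriented link diagram on an oriented surface with `n` crossings and `m` marked points, given
as a signed oriented Gauss code (equivalently, an oriented PD code).  The marked points subdivide
the edges; a component without crossings is a circle carrying at least one marked point.

Leaving the strand `s` along the orientation of the link, the next strand met is `next s`.  The edge
from `s` to `next s` is named `s`, so that `Strand n m` is also the set of edges. -/
@[ext]
structure Diagram (n m : ℕ) where
  next : Equiv.Perm (Strand n m)
  /-- whether a crossing is positive -/
  positive : Fin n → Bool

namespace Diagram

variable {n m : ℕ} (K L : Diagram n m)

/-- The edge that leaves the strand `s`. -/
def outEdge (_K : Diagram n m) (s : Strand n m) : Strand n m := s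

/-- The edge that enters the strand `s`. -/
def inEdge (s : Strand n m) : Strand n m := K.next.symm s

/-- The four edge ends at a crossing in counterclockwise order, beginning with the incoming end of
the under-strand: the edge, and whether it leaves the crossing there. -/
def ends (c : Fin n) : Fin 4 → Strand n m × Bool :=
  if K.positive c then
    ![(K.inEdge (.inl (c, false)), false), (K.outEdge (.inl (c, true)), true),
      (K.outEdge (.inl (c, false)), true), (K.inEdge (.inl (c, true)), false)]
  else
    ![(K.inEdge (.inl (c, false)), false), (K.inEdge (.inl (c, true)), false),
      (K.outEdge (.inl (c, false)), true), (K.outEdge (.inl (c, true)), true)]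

/-- Link components, as the cycles of `next`. -/
def SameComponent (e e' : Strand n m) : Prop := K.next.SameCycle e e'

/-- The number of components of the link. -/
def numComponents : ℕ := Nat.card (Quot K.SameComponent)

/-! #### Planarity -/

/-- The sides of the edges are pairs `(e, b)`, the left side for `b = true` and the right side for
`b = false`.  Two sides are adjacent if they bound the same corner at a vertex.  In the corner from
the end `i` to the counterclockwise next end `i + 1`, one sees the left side of the former and the
right side of the latter, looking out from the vertex. -/
inductive AdjacentSides : Strand n m × Bool → Strand n m × Bool → Prop
  | crossing (c : Fin n) (i : Fin 4) :
      AdjacentSides ((K.ends c i).1, (K.ends c i).2) ((K.ends c (i + 1)).1, !(K.ends c (i + 1)).2)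
  | marked (a : Fin m) (b : Bool) :
      AdjacentSides (K.inEdge (.inr a), b) (K.outEdge (.inr a), b)

/-- The faces of the (connected pieces of the) diagram, as closed boundary walks. -/
abbrev Face : Type := Quot K.AdjacentSides

/-- The vertex (crossing or marked point) of a strand. -/
def vertex : Strand n m → Fin n ⊕ Fin m := Sum.map Prod.fst id

/-- The connected pieces of the underlying graph of the diagram. -/
abbrev Piece : Type := Quot fun x y => ∃ s, x = vertex s ∧ y = vertex (K.next s)

/-- Planarity of a diagram: every connected piece has genus `0`, by Euler's formula
`V - E + F = 2 · (number of pieces)` with `V = n + m` and `E = 2n + m`. -/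
def IsPlanar : Prop :=
  (n + m) + Nat.card K.Face = (2 * n + m) + 2 * Nat.card K.Piece

/-! #### Saddles -/

/-- `L` is obtained from `K` by an oriented saddle along a band between the edges `p` and `q`
(joining points in one connected piece of the diagram).

The band runs inside one face, and the strands are antiparallel there: the face is on the left of
both or on the right of both.  The two edges are cut, and the first half of each is
glued to the second half of the other.  The new edges are again named by the strands they leave. -/
structure IsOrientedSaddle (K L : Diagram n m) (p q : Strand n m) : Prop where
  ne : p ≠ q
  face : ∃ b : Bool, (Quot.mk _ (p, b) : K.Face) = Quot.mk _ (q, b)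
  positive_eq : L.positive = K.positive
  next_eq : L.next = K.next * Equiv.swap p q

/-! ### The cube of resolutions and the complex -/

/-- The joints of edges in the resolution `v`.  With the ends at a crossing numbered `0, 1, 2, 3`
as above, the `0`-smoothing (`v c = false`) joins `0` to `1` and `2` to `3`, and the `1`-smoothing
(`v c = true`) joins `0` to `3` and `1` to `2`. -/
inductive Joined (v : Fin n → Bool) : Strand n m → Strand n m → Prop
  | zero₀₁ (c : Fin n) (h : v c = false) : Joined v (K.ends c 0).1 (K.ends c 1).1
  | zero₂₃ (c : Fin n) (h : v c = false) : Joined v (K.ends c 2).1 (K.ends c 3).1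
  | one₀₃ (c : Fin n) (h : v c = true) : Joined v (K.ends c 0).1 (K.ends c 3).1
  | one₁₂ (c : Fin n) (h : v c = true) : Joined v (K.ends c 1).1 (K.ends c 2).1
  | marked (a : Fin m) : Joined v (K.inEdge (.inr a)) (K.outEdge (.inr a))

/-- The module of the complex: the sum, over the vertices `v` of the cube, of `A^{⊗ circles}`.
The summand of `v` has homological degree `weight v` minus the number of negative crossings. -/
abbrev Chain : Type := (v : Fin n → Bool) → CircleAlg (K.Joined v)

/-- The number of `1`-smoothings. -/
def weight (v : Fin n → Bool) : ℕ := (Finset.univ.filter fun c => v c = true).card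

/-- The sign of the edge of the cube that ends at `w` and changes the crossing `c`. -/
def cubeSign (w : Fin n → Bool) (c : Fin n) : ℤ :=
  (-1) ^ (Finset.univ.filter fun c' => c' < c ∧ w c' = true).card

/-- The differential: the signed sum of the saddle maps along the edges of the cube.  The ends
`0` and `2` at a crossing are on different strands in both smoothings. -/
def d : K.Chain →ₗ[R] K.Chain :=
  LinearMap.pi fun w => ∑ c : Fin n,
    if w c = true then
      cubeSign w c •
        (saddleMap (K.Joined (Function.update w c false)) (K.Joined w)
          (K.ends c 0).1 (K.ends c 2).1 ∘ₗ LinearMap.proj (Function.update w c false))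
    else 0

/-- The `α`-homology `α(K)`, cycles modulo boundaries. -/
abbrev Homology : Type :=
  LinearMap.ker K.d ⧸ (LinearMap.range K.d).submoduleOf (LinearMap.ker K.d)

variable {K L}

/-- Chain maps. -/
def IsChainMap (φ : K.Chain →ₗ[R] L.Chain) : Prop := L.d ∘ₗ φ = φ ∘ₗ K.d

lemma IsChainMap.mapsTo_ker {φ : K.Chain →ₗ[R] L.Chain} (h : IsChainMap φ) :
    ∀ z ∈ LinearMap.ker K.d, φ z ∈ LinearMap.ker L.d := by
  intro z hz
  have h' := LinearMap.congr_fun h z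
  simp only [LinearMap.comp_apply] at h'
  rw [LinearMap.mem_ker] at hz ⊢
  rw [h', hz, map_zero]

/-- The map that a chain map induces on homology. -/
def homologyMap (φ : K.Chain →ₗ[R] L.Chain) (h : IsChainMap φ) : K.Homology →ₗ[R] L.Homology :=
  Submodule.mapQ _ _ (φ.restrict h.mapsTo_ker) (by
    rintro ⟨z, hz⟩ ⟨y, hy⟩
    refine ⟨φ y, ?_⟩
    have h' := LinearMap.congr_fun h y
    simp only [LinearMap.comp_apply] at h'
    simp only [Submodule.subtype_apply] at hy
    simp [h', hy])

/-- `φ` and `ψ` are chain homotopic: `φ - ψ = d h + h d` with `h` of homological degree `-1`. -/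
def Homotopic (φ ψ : K.Chain →ₗ[R] K.Chain) : Prop :=
  ∃ h : K.Chain →ₗ[R] K.Chain,
    (∀ (v w : Fin n → Bool) (x : CircleAlg (K.Joined v)),
      h (Pi.single v x) w ≠ 0 → weight w + 1 = weight v) ∧
    φ - ψ = K.d ∘ₗ h + h ∘ₗ K.d

variable (K L)

/-- The map of complexes induced by a saddle from `K` to `L` along the edges `p` and `q`. -/
def saddleChainMap (p q : Strand n m) : K.Chain →ₗ[R] L.Chain :=
  LinearMap.pi fun v => saddleMap (K.Joined v) (L.Joined v) p q ∘ₗ LinearMap.proj v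

/-- The map of complexes given by placing `a : A` at a point of the edge `e` on the diagram `K`:
multiplication by `a` in the factor of the circle through `e`. -/
def mulAt (a : A) (e : Strand n m) : K.Chain →ₗ[R] K.Chain :=
  LinearMap.pi fun v => LinearMap.mulLeft R (factor (K.Joined v) e a) ∘ₗ LinearMap.proj v

end Diagram

end AlphaHomology

end

noncomputable section

namespace AlphaHomology

/-! ### The Frobenius algebra -/

/-! In each resolution a saddle followed by its reverse is `Δ` then multiplication, or
multiplication then `Δ`. Either way it multiplies by `dotPair` at the two strands, which is `X_p +
X_q - (α₁ + α₂)` (`IsSaddle.comp_reverse`, `saddleChainMap_comp_reverse`).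

At a crossing, the reverse saddle is a homotopy from `0` to multiplication by `dotPair` across that
crossing (`crossingDots_eq`). Hence a point moving past a crossing changes `X` into `α₁ + α₂ - X` up
to homotopy, which negates `Xstar = 2X - (α₁ + α₂)`. Along a component the parity of these changes
is recorded by a checkerboard colouring (`mulAt_X_of_sameComponent`). The band of the saddle runs in
one face, on the same side of `p` and `q`, so these edges have the same colour and `X_q ≃ X_p`. The
composite is therefore homotopic to `Xstar` at `p`, and so to `±Xstar` at `e`; the sign compares the
colours of `p` and `e`.

Planarity enters through the colouring (`IsPlanar.exists_isAlternating`): Euler's formula forces the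
first homology mod `2` to vanish, so the sum of all edges bounds a set of faces. The colouring also
orients all circles of all resolutions coherently. They become cycles of a permutation, and a saddle
multiplies it by a transposition, which always joins two cycles or splits one (`surgery_mul_swap`).
Saddles at different places then commute (`IsSaddle.comm`), which gives `d² = 0` and the chain maps.
-/

lemma adjoin_X : Algebra.adjoin R {X} = ⊤ :=
  AdjoinRoot.adjoinRoot_eq_top (f := relPoly)

/-- Both `A`-actions agree on `Δ(1)`. Since `X` generates `A`, it is enough to check `dot₁`, where
the two expressions for `Δ(1)` both give `dot₁ ⊗ dot₁`. -/
lemma tmul_one_mul_comul_one (x : A) :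
    x ⊗ₜ[R] (1 : A) * comul 1 = (1 : A) ⊗ₜ[R] x * comul 1 := by
  have hx : x ∈ Algebra.adjoin R {X} := adjoin_X ▸ Algebra.mem_top
  induction hx using Algebra.adjoin_induction with
  | mem x hx =>
    obtain rfl : x = X := hx
    have h₁ : X = dot₁ + algebraMap R A α₁ := by simp [dot₁]
    have h₂ : dot₁ ⊗ₜ[R] (1 : A) * comul 1 = (1 : A) ⊗ₜ[R] dot₁ * comul 1 := by
      conv_lhs => rw [comul_one']
      conv_rhs => rw [comul_one]
      simp [mul_add, dot₁_mul_dot₂]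
    rw [h₁, TensorProduct.add_tmul, TensorProduct.tmul_add, add_mul, add_mul, h₂]
    congr 2
    rw [Algebra.algebraMap_eq_smul_one, TensorProduct.smul_tmul]
  | algebraMap r =>
    rw [Algebra.algebraMap_eq_smul_one, TensorProduct.smul_tmul]
  | add x y _ _ hx hy => rw [TensorProduct.add_tmul, TensorProduct.tmul_add, add_mul, add_mul, hx, hy]
  | mul x y _ _ hx hy =>
    have e₁ : (x * y) ⊗ₜ[R] (1 : A) = x ⊗ₜ[R] (1 : A) * y ⊗ₜ[R] (1 : A) := by simp
    have e₂ : (1 : A) ⊗ₜ[R] (x * y) = (1 : A) ⊗ₜ[R] x * (1 : A) ⊗ₜ[R] y := by simp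
    rw [e₁, e₂, mul_assoc, hy, mul_left_comm, hx, mul_left_comm, mul_assoc]

lemma comul_eq (a : A) : comul a = a ⊗ₜ[R] (1 : A) * comul 1 := by
  rw [comul_one, mul_comm]
  rfl

lemma comul_mul (x a : A) : comul (x * a) = x ⊗ₜ[R] (1 : A) * comul a := by
  rw [comul_eq, comul_eq a, ← mul_assoc]
  simp

lemma comul_mul' (x a : A) : comul (x * a) = (1 : A) ⊗ₜ[R] x * comul a := by
  rw [mul_comm, comul_mul, comul_eq x, tmul_one_mul_comul_one, mul_left_comm, ← comul_eq]

/-! ### Circle algebras -/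

section Circles

variable {E : Type}

/-- Two edges lie on one circle. -/
def Conn (r : E → E → Prop) (x y : E) : Prop := Quot.mk r x = Quot.mk r y

lemma factor_congr {r : E → E → Prop} {x y : E} (h : Conn r x y) : factor r x = factor r y := by
  unfold factor
  rw [show Quot.mk r x = Quot.mk r y from h]

/-- The sum of `dot₁` at `x` and `dot₂` at `y`. -/
def dotPair (r : E → E → Prop) (x y : E) : CircleAlg r := factor r x dot₁ + factor r y dot₂

/-- This form is symmetric in the two points, although `α₁` and `α₂` play different roles in
`dotPair`. -/
lemma dotPair_eq (r : E → E → Prop) (x y : E) :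
    dotPair r x y = factor r x X + factor r y X - algebraMap R _ (α₁ + α₂) := by
  simp only [dotPair, dot₁, dot₂, map_sub, AlgHom.commutes, map_add]
  abel

lemma dotPair_comm (r : E → E → Prop) (x y : E) : dotPair r x y = dotPair r y x := by
  rw [dotPair_eq, dotPair_eq, add_comm (factor r x X)]

lemma dotPair_congr {r : E → E → Prop} {x y x' y' : E} (hx : Conn r x x') (hy : Conn r y y') :
    dotPair r x y = dotPair r x' y' := by
  rw [dotPair, dotPair, factor_congr hx, factor_congr hy]

lemma factor₂_tmul (r : E → E → Prop) (i k : E) (a b : A) :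
    factor₂ r i k (a ⊗ₜ b) = factor r i a * factor r k b := by
  simp [factor₂]

lemma factor₂_comul_one (r : E → E → Prop) (i k : E) :
    factor₂ r i k (comul 1) = dotPair r i k := by
  rw [comul_one, map_add, factor₂_tmul, factor₂_tmul]
  simp [dotPair]

/-- The pure tensor with entry `f C` at the circle `C`. -/
def pureTensor (r : E → E → Prop) (f : Quot r → A) : CircleAlg r := PiTensorProduct.tprod R f

open Classical in
lemma factor_mul_pureTensor (r : E → E → Prop) (e : E) (x : A) (f : Quot r → A) :
    factor r e x * pureTensor r f =
      pureTensor r (Function.update (1 : Quot r → A) (Quot.mk r e) x * f) :=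
  PiTensorProduct.tprod_mul_tprod (R := R) _ f

lemma circleAlg_induction {r : E → E → Prop} {p : CircleAlg r → Prop}
    (tprod : ∀ f : Quot r → A, p (pureTensor r f))
    (smul : ∀ (c : R) x, p x → p (c • x))
    (add : ∀ x y, p x → p y → p (x + y)) (x : CircleAlg r) : p x :=
  PiTensorProduct.induction_on x (fun c f => smul c _ (tprod f)) add

variable [Finite E]

open Classical in
/-- The circle algebra is generated by the tensor factors. -/
lemma factor_induction {r : E → E → Prop} {p : CircleAlg r → Prop} (one : p 1)
    (smul : ∀ (c : R) x, p x → p (c • x))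
    (add : ∀ x y, p x → p y → p (x + y))
    (mul : ∀ e a x, p x → p (factor r e a * x)) (x : CircleAlg r) : p x := by
  refine circleAlg_induction (fun f => ?_) smul add x
  have : Fintype (Quot r) := Fintype.ofFinite _
  -- A pure tensor is the product of its entries placed in their factors; they are inserted one
  -- circle at a time.
  have key : ∀ s : Finset (Quot r),
      p (pureTensor r fun C => if C ∈ s then f C else 1) := by
    intro s
    induction s using Finset.induction_on with
    | empty => exact one
    | insert C s hC ih =>
      obtain ⟨e, rfl⟩ := Quot.exists_rep C
      have := mul e (f (Quot.mk r e)) _ ih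
      rw [factor_mul_pureTensor] at this
      convert this using 2
      ext C'
      by_cases h : C' = Quot.mk r e
      · subst h; simp [hC]
      · simp [h]
  simpa using key Finset.univ

end Circles

/-! ### Surgery of equivalence relations -/

section Surgery

variable {H : Type}

/-- The relation `t` arises from the equivalence relation `s` by uniting the distinct classes of
`a` and `b`. -/
def Merges (s t : H → H → Prop) (a b : H) : Prop :=
  ¬ s a b ∧ ∀ x y, t x y ↔ s x y ∨ (s x a ∧ s y b) ∨ (s x b ∧ s y a)

/-- One of `s` and `t` arises from the other by uniting the distinct classes of `a` and `b`. -/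
def Surgery (s t : H → H → Prop) (a b : H) : Prop := Merges s t a b ∨ Merges t s a b

lemma Merges.le {s t : H → H → Prop} {a b x y : H} (h : Merges s t a b) (hxy : s x y) : t x y :=
  (h.2 x y).2 (.inl hxy)

lemma Merges.joins {s t : H → H → Prop} {a b : H} (h : Merges s t a b) (hs : Equivalence s) :
    t a b :=
  (h.2 a b).2 (.inr (.inl ⟨hs.refl a, hs.refl b⟩))

end Surgery

/-! ### Saddle maps and their composition -/

section Saddle

variable {E H : Type}

lemma conn_equivalence (r : E → E → Prop) : Equivalence (Conn r) :=
  ⟨fun _ => rfl, fun h => Eq.symm h, fun h h' => Eq.trans h h'⟩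

lemma factor_mul_factor₂_comul {r : E → E → Prop} {i k e : E} (h : Conn r e i ∨ Conn r e k)
    (x a : A) :
    factor r e x * factor₂ r i k (comul a) = factor₂ r i k (comul (x * a)) := by
  rcases h with h | h
  · rw [comul_mul, map_mul, factor₂_tmul, map_one, mul_one, factor_congr h]
  · rw [comul_mul', map_mul, factor₂_tmul, map_one, one_mul, factor_congr h]

/-- A map of circle algebras that is given by a saddle between the points `a` and `b`.  The points
`h : H` of the diagram lie on the edges `φ h` before and `φ' h` after the saddle. -/
structure IsSaddle (r r' : E → E → Prop) (φ φ' : H → E) (a b : H)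
    (S : CircleAlg r →ₗ[R] CircleAlg r') : Prop where
  surgery : Surgery (fun x y => Conn r (φ x) (φ y)) (fun x y => Conn r' (φ' x) (φ' y)) a b
  map_factor_mul : ∀ h x y, S (factor r (φ h) x * y) = factor r' (φ' h) x * S y
  map_one_of_conn : Conn r (φ a) (φ b) → S 1 = dotPair r' (φ' a) (φ' b)
  map_one_of_not_conn : ¬ Conn r (φ a) (φ b) → S 1 = 1

lemma IsSaddle.map_dotPair {r r' : E → E → Prop} {φ φ' : H → E} {a b : H}
    {S : CircleAlg r →ₗ[R] CircleAlg r'} (h : IsSaddle r r' φ φ' a b S) (x y : H) :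
    S (dotPair r (φ x) (φ y)) = dotPair r' (φ' x) (φ' y) * S 1 := by
  rw [← mul_one (dotPair r (φ x) (φ y)), dotPair, add_mul, map_add, h.map_factor_mul,
    h.map_factor_mul, ← add_mul, ← dotPair]

lemma IsSaddle.cases {r r' : E → E → Prop} {φ φ' : H → E} {a b : H}
    {S : CircleAlg r →ₗ[R] CircleAlg r'} (h : IsSaddle r r' φ φ' a b S) :
    (Merges (fun x y => Conn r (φ x) (φ y)) (fun x y => Conn r' (φ' x) (φ' y)) a b ∧ S 1 = 1) ∨
    (Merges (fun x y => Conn r' (φ' x) (φ' y)) (fun x y => Conn r (φ x) (φ y)) a b ∧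
      S 1 = dotPair r' (φ' a) (φ' b)) := by
  rcases h.surgery with hs | hs
  · exact .inl ⟨hs, h.map_one_of_not_conn hs.1⟩
  · exact .inr ⟨hs, h.map_one_of_conn ((hs.2 a b).2 (.inr (.inl ⟨rfl, rfl⟩)))⟩

variable [Finite E]

open Classical in
lemma saddleMap_pureTensor (r r' : E → E → Prop) (i k : E) (f : Quot r → A) :
    haveI : Fintype (Quot r) := Fintype.ofFinite _
    saddleMap r r' i k (pureTensor r f) =
      ∏ C, (if Quot.mk r i = Quot.mk r k ∧ C = Quot.mk r i then
        (factor₂ r' i k).toLinearMap ∘ₗ comul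
      else
        (factor r' C.out).toLinearMap) (f C) := by
  simp only [saddleMap, pureTensor]
  erw [PiTensorProduct.lift.tprod]
  simp [MultilinearMap.compLinearMap_apply]

open Classical in
-- On the circle that splits this is the `A`-linearity of `Δ` in either tensor factor; elsewhere the
-- map is multiplicative in the entries.
lemma saddleMap_factor_mul {r r' : E → E → Prop} {i k : E} (h : Surgery (Conn r) (Conn r') i k)
    (e : E) (x : A) (y : CircleAlg r) :
    saddleMap r r' i k (factor r e x * y) = factor r' e x * saddleMap r r' i k y := by
  induction y using circleAlg_induction with
  | smul c y hy => rw [mul_smul_comm, map_smul, map_smul, hy, mul_smul_comm]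
  | add y z hy hz => rw [mul_add, map_add, map_add, mul_add, hy, hz]
  | tprod f =>
    let _ : Fintype (Quot r) := Fintype.ofFinite _
    rw [factor_mul_pureTensor, saddleMap_pureTensor, saddleMap_pureTensor]
    rw [← Finset.mul_prod_erase _ _ (Finset.mem_univ (Quot.mk r e)),
      ← Finset.mul_prod_erase _ _ (Finset.mem_univ (Quot.mk r e)), ← mul_assoc]
    congr 1
    · rw [Pi.mul_apply, Function.update_self]
      split_ifs with hc
      · have hik : Conn r i k := hc.1
        have hei : Conn r e i := hc.2
        refine (factor_mul_factor₂_comul ?_ x (f _)).symm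
        rcases h with h | h
        · exact absurd hik h.1
        · rcases (h.2 e i).1 hei with h' | h' | h'
          · exact .inl h'
          · exact .inl h'.1
          · exact .inr h'.1
      · have ho : Conn r (Quot.mk r e).out e := Quot.out_eq (Quot.mk r e)
        -- The representative of an unsplit circle still lies with `e` afterwards, so the choice
        -- made by `out` is harmless.
        have : Conn r' (Quot.mk r e).out e := by
          rcases h with h | h
          · exact (h.2 _ _).2 (.inl ho)
          · have hi : Conn r' i i := rfl
            have hk : Conn r' k k := rfl
            have hik : Conn r i k := (h.2 _ _).2 (.inr (.inl ⟨hi, hk⟩))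
            have hei : ¬ Conn r e i := fun h' => hc ⟨hik, h'⟩
            rcases (h.2 _ _).1 ho with h' | h' | h'
            · exact h'
            · exact absurd ((h.2 e i).2 (.inr (.inr ⟨h'.2, hi⟩))) hei
            · exact absurd ((h.2 e i).2 (.inl h'.2)) hei
        simp [factor_congr this]
    · refine Finset.prod_congr rfl fun C hC => ?_
      rw [Pi.mul_apply, Function.update_of_ne (Finset.ne_of_mem_erase hC)]
      simp

open Classical in
lemma saddleMap_one_of_conn {r r' : E → E → Prop} {i k : E} (h : Conn r i k) :
    saddleMap r r' i k 1 = dotPair r' i k := by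
  let _ : Fintype (Quot r) := Fintype.ofFinite _
  have := saddleMap_pureTensor r r' i k 1
  rw [← Finset.mul_prod_erase _ _ (Finset.mem_univ (Quot.mk r i)), if_pos ⟨h, rfl⟩,
    Finset.prod_eq_one] at this
  · refine this.trans ?_
    simpa using factor₂_comul_one r' i k
  · intro C hC
    rw [if_neg fun h' => Finset.ne_of_mem_erase hC h'.2]
    simp

open Classical in
lemma saddleMap_one_of_not_conn {r r' : E → E → Prop} {i k : E} (h : ¬ Conn r i k) :
    saddleMap r r' i k 1 = 1 := by
  let _ : Fintype (Quot r) := Fintype.ofFinite _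
  refine (saddleMap_pureTensor r r' i k 1).trans (Finset.prod_eq_one fun C _ => ?_)
  rw [if_neg fun h' => h h'.1]
  simp

/-- Maps that commute with the action of `A` at every point are determined by their value at `1`. -/
lemma linearMap_ext_of_factor {r s : E → E → Prop} {φ : H → E} (hφ : φ.Surjective) {ψ : H → E}
    {S T : CircleAlg r →ₗ[R] CircleAlg s}
    (hS : ∀ h x y, S (factor r (φ h) x * y) = factor s (ψ h) x * S y)
    (hT : ∀ h x y, T (factor r (φ h) x * y) = factor s (ψ h) x * T y)
    (h1 : S 1 = T 1) : S = T := by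
  ext1 y
  induction y using factor_induction with
  | one => exact h1
  | smul c x hx => rw [map_smul, map_smul, hx]
  | add x y hx hy => rw [map_add, map_add, hx, hy]
  | mul e a x hx =>
    obtain ⟨h, rfl⟩ := hφ e
    rw [hS, hT, hx]

/-- A saddle followed by its reverse is multiplication by `dot₁ + dot₂` on the two strands. -/
lemma IsSaddle.comp_reverse {r r' : E → E → Prop} {φ φ' : H → E} (hφ : φ.Surjective) {a b : H}
    {S : CircleAlg r →ₗ[R] CircleAlg r'} {T : CircleAlg r' →ₗ[R] CircleAlg r}
    (hS : IsSaddle r r' φ φ' a b S) (hT : IsSaddle r' r φ' φ a b T) :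
    T ∘ₗ S = LinearMap.mulLeft R (dotPair r (φ a) (φ b)) := by
  refine linearMap_ext_of_factor hφ (ψ := φ) ?_ ?_ ?_
  · intro h x y
    simp only [LinearMap.comp_apply, hS.map_factor_mul, hT.map_factor_mul]
  · intro h x y
    simp only [LinearMap.mulLeft_apply]
    ring
  · have h' : ∀ x, Conn r (φ x) (φ x) := fun _ => rfl
    have h'' : ∀ x, Conn r' (φ' x) (φ' x) := fun _ => rfl
    rw [LinearMap.comp_apply, LinearMap.mulLeft_apply, mul_one]
    by_cases h : Conn r (φ a) (φ b)
    · rw [hS.map_one_of_conn h, hT.map_dotPair, hT.map_one_of_not_conn, mul_one]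
      intro hc
      rcases hS.surgery with hs | hs
      · exact hs.1 h
      · exact hs.1 hc
    · rw [hS.map_one_of_not_conn h, hT.map_one_of_conn]
      rcases hS.surgery with hs | hs
      · exact (hs.2 a b).2 (.inr (.inl ⟨h' _, h' _⟩))
      · exact absurd ((hs.2 a b).2 (.inr (.inl ⟨h'' _, h'' _⟩))) h

/-- Saddles at different places commute. -/
lemma IsSaddle.comm {r s t u : E → E → Prop} {φr φs φt φu : H → E} (hφ : φr.Surjective)
    {a b c d : H} {S : CircleAlg r →ₗ[R] CircleAlg s} {S' : CircleAlg s →ₗ[R] CircleAlg u}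
    {T : CircleAlg r →ₗ[R] CircleAlg t} {T' : CircleAlg t →ₗ[R] CircleAlg u}
    (hS : IsSaddle r s φr φs a b S) (hS' : IsSaddle s u φs φu c d S')
    (hT : IsSaddle r t φr φt c d T) (hT' : IsSaddle t u φt φu a b T') :
    S' ∘ₗ S = T' ∘ₗ T := by
  refine linearMap_ext_of_factor hφ (ψ := φu) ?_ ?_ ?_
  · intro h x y
    simp only [LinearMap.comp_apply, hS.map_factor_mul, hS'.map_factor_mul]
  · intro h x y
    simp only [LinearMap.comp_apply, hT.map_factor_mul, hT'.map_factor_mul]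
  rw [LinearMap.comp_apply, LinearMap.comp_apply]
  have hu : (Conn u (φu a) (φu c) ∧ Conn u (φu b) (φu d)) ∨
      (Conn u (φu a) (φu d) ∧ Conn u (φu b) (φu c)) →
      dotPair u (φu a) (φu b) = dotPair u (φu c) (φu d) := by
    rintro (⟨h, h'⟩ | ⟨h, h'⟩)
    · exact dotPair_congr h h'
    · rw [dotPair_congr h h', dotPair_comm]
  have er := (conn_equivalence r).comap φr
  have es := (conn_equivalence s).comap φs
  have et := (conn_equivalence t).comap φt
  have eu := (conn_equivalence u).comap φu
  -- Each of the four saddles merges or splits. Most of the sixteen patterns are inconsistent. Where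
  -- both routes merge and then split, or both split and then merge, the values at `1` are `dotPair`
  -- at different pairs of points; `hu` matches them in `u`.
  obtain ⟨m₁, v₁⟩ | ⟨m₁, v₁⟩ := hS.cases <;> obtain ⟨m₂, v₂⟩ | ⟨m₂, v₂⟩ := hS'.cases <;>
  obtain ⟨m₃, v₃⟩ | ⟨m₃, v₃⟩ := hT.cases <;> obtain ⟨m₄, v₄⟩ | ⟨m₄, v₄⟩ := hT'.cases <;>
  simp only [v₁, v₂, v₃, v₄, hS'.map_dotPair, hT'.map_dotPair, mul_one]
  · exact absurd (m₂.le (m₁.joins er)) m₄.1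
  · exact absurd (m₁.le (m₃.joins et)) m₂.1
  · exact absurd (m₁.le (m₃.joins et)) m₂.1
  · exact absurd (m₄.le (m₃.joins er)) m₂.1
  · exact (hu (((m₂.2 a b).1 (m₁.joins er)).resolve_left m₄.1)).symm
  · exact absurd (m₃.le (m₄.joins eu)) m₁.1
  · exact absurd (m₃.le (m₁.joins es)) m₄.1
  · refine hu ?_
    rcases ((m₁.2 c d).1 (m₃.joins et)).resolve_left m₂.1 with h | h
    · exact .inl ⟨eu.symm (m₂.le h.1), eu.symm (m₂.le h.2)⟩
    · exact .inr ⟨eu.symm (m₂.le h.2), eu.symm (m₂.le h.1)⟩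
  · exact absurd (m₄.le (m₂.joins es)) m₃.1
  · exact absurd (m₁.le (m₂.joins eu)) m₃.1
  · exact absurd (m₁.le (m₂.joins eu)) m₃.1
  · exact absurd (m₂.le (m₄.joins et)) m₁.1
  · exact mul_comm _ _

end Saddle

/-! ### Cycles of a permutation and transpositions -/

section Swap

open Equiv Equiv.Perm

variable {H : Type} [Finite H]

lemma sameCycle_imp_of_step {π : Perm H} {T : H → H → Prop} (hT : Equivalence T)
    (h : ∀ x, T x (π x)) {x y : H} (hxy : π.SameCycle x y) : T x y := by
  obtain ⟨k, rfl⟩ := hxy.exists_nat_pow_eq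
  induction k with
  | zero => exact hT.refl x
  | succ k ih =>
    rw [pow_succ', Perm.mul_apply]
    exact hT.trans (ih ⟨k, by simp⟩) (h _)

variable [DecidableEq H]

/-- The right-hand side is an equivalence relation containing every step `x ↦ π (swap a b x)`. -/
lemma sameCycle_mul_swap_imp {π : Perm H} {a b x y : H} (h : (π * swap a b).SameCycle x y) :
    π.SameCycle x y ∨ (π.SameCycle x a ∧ π.SameCycle y b) ∨
      (π.SameCycle x b ∧ π.SameCycle y a) := by
  refine sameCycle_imp_of_step (T := fun x y => π.SameCycle x y ∨
    (π.SameCycle x a ∧ π.SameCycle y b) ∨ (π.SameCycle x b ∧ π.SameCycle y a))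
    ⟨fun x => .inl (.refl _ _), ?_, ?_⟩ ?_ h
  · rintro x y (h | h | h)
    · exact .inl h.symm
    · exact .inr (.inr h.symm)
    · exact .inr (.inl h.symm)
  · rintro x y z (h | h | h) (h' | h' | h')
    · exact .inl (h.trans h')
    · exact .inr (.inl ⟨h.trans h'.1, h'.2⟩)
    · exact .inr (.inr ⟨h.trans h'.1, h'.2⟩)
    · exact .inr (.inl ⟨h.1, h'.symm.trans h.2⟩)
    · exact .inl (h.1.trans (h'.1.symm.trans (h.2.trans h'.2.symm)))
    · exact .inl (h.1.trans h'.2.symm)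
    · exact .inr (.inr ⟨h.1, h'.symm.trans h.2⟩)
    · exact .inl (h.1.trans h'.2.symm)
    · exact .inl (h.1.trans (h'.1.symm.trans (h.2.trans h'.2.symm)))
  · intro x
    rw [Perm.mul_apply]
    rcases eq_or_ne x a with rfl | ha
    · rw [swap_apply_left]
      exact .inr (.inl ⟨.refl _ _, (sameCycle_apply_left).2 (.refl _ _)⟩)
    rcases eq_or_ne x b with rfl | hb
    · rw [swap_apply_right]
      exact .inr (.inr ⟨.refl _ _, (sameCycle_apply_left).2 (.refl _ _)⟩)
    · rw [swap_apply_of_ne_of_ne ha hb]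
      exact .inl ((sameCycle_apply_right).2 (.refl _ _))

/-- The new permutation sends `a` to `π b` and then follows the old cycle of `b`, which avoids `a`,
until it reaches `b`. -/
lemma sameCycle_mul_swap_of_not {π : Perm H} {a b : H} (h : ¬ π.SameCycle a b) :
    (π * swap a b).SameCycle a b := by
  have key : ∀ k : ℕ, (π * swap a b).SameCycle a ((π ^ (k + 1)) b) := by
    have h1 : (π * swap a b).SameCycle a (π b) := by
      have : π b = (π * swap a b) a := by simp
      rw [this]
      exact (sameCycle_apply_right).2 (.refl _ _)
    intro k
    induction k with
    | zero => simpa using h1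
    | succ k ih =>
      rw [pow_succ', Perm.mul_apply]
      by_cases hb : (π ^ (k + 1)) b = b
      · rwa [hb]
      · have ha : (π ^ (k + 1)) b ≠ a := fun ha =>
          h (SameCycle.symm ⟨((k + 1 : ℕ) : ℤ), by rw [zpow_natCast]; exact ha⟩)
        have : π ((π ^ (k + 1)) b) = (π * swap a b) ((π ^ (k + 1)) b) := by
          rw [Perm.mul_apply, swap_apply_of_ne_of_ne ha hb]
        rw [this]
        exact (sameCycle_apply_right).2 ih
  have := key (orderOf π - 1)
  rwa [Nat.sub_add_cancel (orderOf_pos π), pow_orderOf_eq_one] at this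

/-- With `k` the least exponent such that `π ^ k` takes `a` to `b`, the new orbit of `b` stays in
the arc `π a, …, π ^ k a = b`, which misses `a`. -/
lemma not_sameCycle_mul_swap {π : Perm H} {a b : H} (hab : a ≠ b) (h : π.SameCycle a b) :
    ¬ (π * swap a b).SameCycle a b := by
  classical
  have hex : ∃ k, (π ^ k) a = b := h.exists_nat_pow_eq
  set k := Nat.find hex
  have hk : (π ^ k) a = b := Nat.find_spec hex
  have hk0 : 0 < k := by
    rcases Nat.eq_zero_or_pos k with h0 | h0
    · rw [h0] at hk
      exact absurd hk hab
    · exact h0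
  have hmin : ∀ j < k, (π ^ j) a ≠ b := fun j hj => Nat.find_min hex hj
  have hret : ∀ i, 0 < i → i ≤ k → (π ^ i) a ≠ a := by
    intro i hi hik hia
    apply hmin (k - i) (by omega)
    rw [← hk]
    conv_rhs => rw [← Nat.sub_add_cancel hik, pow_add, Perm.mul_apply, hia]
  have inv : ∀ j : ℕ, ∃ i, 0 < i ∧ i ≤ k ∧ (π ^ i) a = ((π * swap a b) ^ j) b := by
    intro j
    induction j with
    | zero => exact ⟨k, hk0, le_rfl, hk⟩
    | succ j ih =>
      obtain ⟨i, hi, hik, hia⟩ := ih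
      rw [pow_succ', Perm.mul_apply, ← hia, Perm.mul_apply]
      rcases hik.eq_or_lt with rfl | hik
      · exact ⟨1, one_pos, hi, by rw [hk, swap_apply_right, pow_one]⟩
      · refine ⟨i + 1, by omega, by omega, ?_⟩
        rw [swap_apply_of_ne_of_ne (hret i hi hik.le) (hmin i hik), pow_succ', Perm.mul_apply]
  intro h'
  obtain ⟨j, hj⟩ := h'.symm.exists_nat_pow_eq
  obtain ⟨i, hi, hik, hia⟩ := inv j
  exact hret i hi hik (hia.trans hj)

lemma merges_mul_swap_of_not {π : Perm H} {a b : H} (h : ¬ π.SameCycle a b) :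
    Merges π.SameCycle (π * swap a b).SameCycle a b := by
  have hs := sameCycle_mul_swap_of_not h
  have hle : ∀ x y, π.SameCycle x y → (π * swap a b).SameCycle x y := by
    intro x y hxy
    -- A second transposition restores `π`; as `a` and `b` now share a cycle, the three alternatives
    -- collapse into one.
    have : ((π * swap a b) * swap a b).SameCycle x y := by
      rwa [mul_assoc, swap_mul_self, mul_one]
    rcases sameCycle_mul_swap_imp this with h | h | h
    · exact h
    · exact h.1.trans (hs.trans h.2.symm)
    · exact h.1.trans (hs.symm.trans h.2.symm)
  refine ⟨h, fun x y => ⟨sameCycle_mul_swap_imp, ?_⟩⟩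
  rintro (h | h | h)
  · exact hle _ _ h
  · exact (hle _ _ h.1).trans (hs.trans (hle _ _ h.2).symm)
  · exact (hle _ _ h.1).trans (hs.symm.trans (hle _ _ h.2).symm)

/-- Multiplying by a transposition joins two cycles or splits a cycle. -/
lemma surgery_mul_swap (π : Perm H) {a b : H} (hab : a ≠ b) :
    Surgery π.SameCycle (π * swap a b).SameCycle a b := by
  by_cases h : π.SameCycle a b
  · right
    have := merges_mul_swap_of_not (not_sameCycle_mul_swap hab h)
    rwa [mul_assoc, swap_mul_self, mul_one] at this
  · exact .inl (merges_mul_swap_of_not h)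

end Swap

namespace Diagram

variable {n m : ℕ}

/-! ### Half-edges and resolutions -/

/-- The two half-edges at a strand: `(s, true)` leaves the strand and `(s, false)` enters it. -/
abbrev HalfEdge (n m : ℕ) : Type := Strand n m × Bool

/-- The edge of a half-edge. -/
def edge (K : Diagram n m) : HalfEdge n m → Strand n m
  | (s, true) => s
  | (s, false) => K.inEdge s

/-- The other half of the edge. -/
def across (K : Diagram n m) : HalfEdge n m → HalfEdge n m
  | (s, true) => (K.next s, false)
  | (s, false) => (K.next.symm s, true)

/-- The half-edge joined to a given one at its vertex in the resolution `v`. -/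
def joint (K : Diagram n m) (v : Fin n → Bool) : HalfEdge n m → HalfEdge n m
  -- In and out are exchanged exactly in the smoothing that respects the orientation: the
  -- `0`-smoothing of a positive crossing, the `1`-smoothing of a negative one.
  | (.inl (c, o), b) => (.inl (c, !o), b ^^ (K.positive c ^^ v c))
  | (.inr a, b) => (.inr a, !b)

lemma across_across (K : Diagram n m) (h : HalfEdge n m) : K.across (K.across h) = h := by
  rcases h with ⟨s, _ | _⟩ <;> simp [across]

lemma joint_joint (K : Diagram n m) (v : Fin n → Bool) (h : HalfEdge n m) :
    K.joint v (K.joint v h) = h := by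
  rcases h with ⟨⟨c, o⟩ | a, b⟩ <;> simp [joint]

lemma edge_across (K : Diagram n m) (h : HalfEdge n m) : K.edge (K.across h) = K.edge h := by
  rcases h with ⟨s, _ | _⟩ <;> simp [across, edge, inEdge]

lemma edge_surjective (K : Diagram n m) : K.edge.Surjective := fun s => ⟨(s, true), rfl⟩

lemma conn_edge_joint (K : Diagram n m) (v : Fin n → Bool) (h : HalfEdge n m) :
    Conn (K.Joined v) (K.edge h) (K.edge (K.joint v h)) := by
  rcases h with ⟨⟨c, o⟩ | a, b⟩
  · have h₁ := Joined.zero₀₁ (K := K) (v := v) c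
    have h₂ := Joined.zero₂₃ (K := K) (v := v) c
    have h₃ := Joined.one₀₃ (K := K) (v := v) c
    have h₄ := Joined.one₁₂ (K := K) (v := v) c
    cases hp : K.positive c <;> cases hv : v c <;> cases o <;> cases b <;>
    simp only [ends, hp, hv, outEdge, if_true, Bool.false_eq_true, if_false, forall_true_left,
      reduceCtorEq, Matrix.cons_val, IsEmpty.forall_iff] at h₁ h₂ h₃ h₄ <;>
    simp only [joint, edge, hp, hv, Bool.not_true, Bool.not_false, Bool.xor_self, Bool.xor_true,
      Bool.xor_false] <;>
    first
    | exact Quot.sound h₁ | exact Quot.sound h₂ | exact (Quot.sound h₁).symm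
    | exact (Quot.sound h₂).symm | exact Quot.sound h₃ | exact Quot.sound h₄
    | exact (Quot.sound h₃).symm | exact (Quot.sound h₄).symm
  · cases b
    · exact Quot.sound (Joined.marked a)
    · exact (Quot.sound (Joined.marked a)).symm

/-- A two-colouring of the half-edges, such that the two halves of an edge and the half-edges that
are joined in a resolution have different colours.  It orients every edge (from the half coloured
`false` to the half coloured `true`), so that the orientations alternate at the crossings. -/
structure IsAlternating (K : Diagram n m) (κ : HalfEdge n m → Bool) : Prop where
  across : ∀ h, κ (K.across h) = !κ h
  crossing : ∀ c b b', κ (.inl (c, true), b) = !κ (.inl (c, false), b')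
  marked : ∀ a, κ (.inr a, true) = !κ (.inr a, false)

namespace IsAlternating

variable {K : Diagram n m} {κ : HalfEdge n m → Bool}

/-- Both smoothings join the over-strand to the under-strand, and these have opposite colours. -/
lemma joint (hκ : IsAlternating K κ) (v : Fin n → Bool) (h : HalfEdge n m) :
    κ (K.joint v h) = !κ h := by
  rcases h with ⟨⟨c, _ | _⟩ | a, b⟩
  · simp only [Diagram.joint, Bool.not_false, hκ.crossing c _ b]
  · simp only [Diagram.joint, Bool.not_true, hκ.crossing c b (b ^^ (K.positive c ^^ v c)),
      Bool.not_not]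
  · cases b <;> simp [Diagram.joint, hκ.marked a]

lemma not (hκ : IsAlternating K κ) : IsAlternating K fun h => !κ h :=
  ⟨fun h => by rw [hκ.across], fun c b b' => by rw [hκ.crossing c b b'],
    fun a => by rw [hκ.marked]⟩

/-- The permutation of half-edges that runs along the circles of a resolution. -/
def perm (hκ : IsAlternating K κ) (v : Fin n → Bool) : Equiv.Perm (HalfEdge n m) where
  -- Colours alternate along a circle, so passing vertices from `true` and edges from `false` never
  -- reverses direction.
  toFun h := if κ h then K.joint v h else K.across h
  invFun h := if κ h then K.across h else K.joint v h
  left_inv h := by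
    cases hh : κ h
    · simp [hκ.across, hh, across_across]
    · simp [hκ.joint, hh, joint_joint]
  right_inv h := by
    cases hh : κ h
    · simp [hκ.joint, hh, joint_joint]
    · simp [hκ.across, hh, across_across]

lemma perm_apply (hκ : IsAlternating K κ) (v : Fin n → Bool) (h : HalfEdge n m) :
    hκ.perm v h = if κ h then K.joint v h else K.across h := rfl

lemma sameCycle_across (hκ : IsAlternating K κ) (v : Fin n → Bool) (h : HalfEdge n m) :
    (hκ.perm v).SameCycle h (K.across h) := by
  cases hh : κ h
  · have : K.across h = hκ.perm v h := by simp [perm_apply, hh]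
    rw [this]
    exact Equiv.Perm.sameCycle_apply_right.2 (.refl _ _)
  · have : h = hκ.perm v (K.across h) := by simp [perm_apply, hκ.across, hh, across_across]
    conv_lhs => rw [this]
    exact Equiv.Perm.sameCycle_apply_left.2 (.refl _ _)

lemma sameCycle_joint (hκ : IsAlternating K κ) (v : Fin n → Bool) (h : HalfEdge n m) :
    (hκ.perm v).SameCycle h (K.joint v h) := by
  cases hh : κ h
  · have : h = hκ.perm v (K.joint v h) := by simp [perm_apply, hκ.joint, hh, joint_joint]
    conv_lhs => rw [this]
    exact Equiv.Perm.sameCycle_apply_left.2 (.refl _ _)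
  · have : K.joint v h = hκ.perm v h := by simp [perm_apply, hh]
    rw [this]
    exact Equiv.Perm.sameCycle_apply_right.2 (.refl _ _)

lemma sameCycle_edge (hκ : IsAlternating K κ) (v : Fin n → Bool) (h : HalfEdge n m) :
    (hκ.perm v).SameCycle h (K.edge h, true) := by
  rcases h with ⟨s, _ | _⟩
  · exact hκ.sameCycle_across v (s, false)
  · exact .refl _ _

lemma sameCycle_of_joined (hκ : IsAlternating K κ) (v : Fin n → Bool) {x y : Strand n m}
    (h : K.Joined v x y) : (hκ.perm v).SameCycle (x, true) (y, true) := by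
  suffices H : ∃ h, K.edge h = x ∧ K.edge (K.joint v h) = y by
    obtain ⟨t, rfl, rfl⟩ := H
    exact (hκ.sameCycle_edge v t).symm.trans
      ((hκ.sameCycle_joint v t).trans (hκ.sameCycle_edge v _))
  cases h with
  | zero₀₁ c h =>
    refine ⟨(.inl (c, false), false), ?_⟩
    cases hp : K.positive c <;> simp [edge, Diagram.joint, ends, hp, h, outEdge]
  | zero₂₃ c h =>
    refine ⟨(.inl (c, false), true), ?_⟩
    cases hp : K.positive c <;> simp [edge, Diagram.joint, ends, hp, h, outEdge]
  | one₀₃ c h =>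
    refine ⟨(.inl (c, false), false), ?_⟩
    cases hp : K.positive c <;> simp [edge, Diagram.joint, ends, hp, h, outEdge]
  | one₁₂ c h =>
    cases hp : K.positive c
    · refine ⟨(.inl (c, true), false), ?_⟩
      simp [edge, Diagram.joint, ends, hp, h, outEdge]
    · refine ⟨(.inl (c, true), true), ?_⟩
      simp [edge, Diagram.joint, ends, hp, h, outEdge]
  | marked a => exact ⟨(.inr a, false), rfl, rfl⟩

/-- The circles of a resolution are the cycles of the permutation of half-edges. -/
lemma conn_iff (hκ : IsAlternating K κ) (v : Fin n → Bool) (h h' : HalfEdge n m) :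
    Conn (K.Joined v) (K.edge h) (K.edge h') ↔ (hκ.perm v).SameCycle h h' := by
  constructor
  · intro hc
    let F : Quot (K.Joined v) → Quotient (Equiv.Perm.SameCycle.setoid (hκ.perm v)) :=
      Quot.lift (fun e => Quotient.mk _ (e, true))
        fun x y hxy => Quotient.sound (hκ.sameCycle_of_joined v hxy)
    have : (hκ.perm v).SameCycle (K.edge h, true) (K.edge h', true) :=
      Quotient.exact (congrArg F hc)
    exact (hκ.sameCycle_edge v h).trans (this.trans (hκ.sameCycle_edge v h').symm)
  · refine sameCycle_imp_of_step ((conn_equivalence (K.Joined v)).comap K.edge) fun x => ?_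
    rw [perm_apply]
    split_ifs
    · exact K.conn_edge_joint v x
    · exact congrArg (Quot.mk _) (K.edge_across x).symm

end IsAlternating

/-! ### Saddles of resolutions -/

/-- The edge ends `0` and `2` at a crossing are the two halves of the under-strand. -/
lemma ends_zero (K : Diagram n m) (c : Fin n) : (K.ends c 0).1 = K.edge (.inl (c, false), false) := by
  cases hp : K.positive c <;> simp [ends, edge, hp]

lemma ends_two (K : Diagram n m) (c : Fin n) : (K.ends c 2).1 = K.edge (.inl (c, false), true) := by
  cases hp : K.positive c <;> simp [ends, edge, hp, outEdge]

/-- The resolution `w` differs from `v` exactly at the crossing `c`. -/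
def Flip (c : Fin n) (v w : Fin n → Bool) : Prop := w c = (!v c) ∧ ∀ c' ≠ c, w c' = v c'

/-- Both halves of the under-strand have one colour. If it is `true`, changing the smoothing
multiplies the circle permutation by their transposition; otherwise the complementary colouring is
used. -/
lemma surgery_crossing {K : Diagram n m} {κ : HalfEdge n m → Bool} (hκ : IsAlternating K κ)
    {c : Fin n} {v w : Fin n → Bool} (hvw : Flip c v w) :
    Surgery (fun x y => Conn (K.Joined v) (K.edge x) (K.edge y))
      (fun x y => Conn (K.Joined w) (K.edge x) (K.edge y))
      (.inl (c, false), false) (.inl (c, false), true) := by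
  obtain ⟨hc, hne⟩ := hvw
  wlog h0 : κ (.inl (c, false), false) = true generalizing κ
  · exact this hκ.not (by simpa using h0)
  have h1 : κ (.inl (c, false), true) = true := by
    have h := hκ.crossing c true true
    rw [hκ.crossing c true false, h0] at h
    simpa using h.symm
  have ht : ∀ b, κ (.inl (c, true), b) = false := fun b => by
    rw [hκ.crossing c b false, h0]; rfl
  have hperm : hκ.perm w = hκ.perm v *
      Equiv.swap (.inl (c, false), false) (.inl (c, false), true) := by
    ext1 h
    rw [Equiv.Perm.mul_apply]
    rcases h with ⟨⟨c', o⟩ | a, b⟩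
    · by_cases hcc : c' = c
      · subst hcc
        cases o
        · cases b <;> simp [IsAlternating.perm_apply, h0, h1, joint, hc]
        · rw [Equiv.swap_apply_of_ne_of_ne (by simp) (by simp)]
          simp [IsAlternating.perm_apply, ht]
      · rw [Equiv.swap_apply_of_ne_of_ne (by simp [hcc]) (by simp [hcc])]
        simp [IsAlternating.perm_apply, joint, hne c' hcc]
    · rw [Equiv.swap_apply_of_ne_of_ne (by simp) (by simp)]
      simp [IsAlternating.perm_apply, joint]
  simp only [hκ.conn_iff, hperm]
  exact surgery_mul_swap _ (by simp)

/-- The saddle map at a crossing. -/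
lemma isSaddle_crossing {K : Diagram n m} {κ : HalfEdge n m → Bool} (hκ : IsAlternating K κ)
    {c : Fin n} {v w : Fin n → Bool} (hvw : Flip c v w) :
    IsSaddle (K.Joined v) (K.Joined w) K.edge K.edge
      (.inl (c, false), false) (.inl (c, false), true)
      (saddleMap (K.Joined v) (K.Joined w) (K.ends c 0).1 (K.ends c 2).1) := by
  have hs := surgery_crossing hκ hvw
  rw [ends_zero, ends_two]
  refine ⟨hs, fun h x y => saddleMap_factor_mul ?_ _ x y, saddleMap_one_of_conn,
    saddleMap_one_of_not_conn⟩
  have lift : ∀ {r s : Strand n m → Strand n m → Prop} {a b : HalfEdge n m},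
      Merges (fun x y => r (K.edge x) (K.edge y)) (fun x y => s (K.edge x) (K.edge y)) a b →
      Merges r s (K.edge a) (K.edge b) :=
    fun h => ⟨h.1, fun x y => h.2 (x, true) (y, true)⟩
  exact hs.imp lift lift

/-- Halves of equal colour are exchanged, so one colouring serves both diagrams and `L` needs no
checkerboard argument of its own. -/
lemma IsAlternating.of_saddle {K L : Diagram n m} {p q : Strand n m} {κ : HalfEdge n m → Bool}
    (hκ : IsAlternating K κ) (hs : L.next = K.next * Equiv.swap p q)
    (hpq : κ (p, true) = κ (q, true)) : IsAlternating L κ := by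
  have key : ∀ s, κ (L.next s, false) = !κ (s, true) := by
    intro s
    have : ∀ s, κ (K.next s, false) = !κ (s, true) := fun s => hκ.across (s, true)
    rw [hs, Equiv.Perm.mul_apply, this]
    congr 1
    rcases eq_or_ne s p with rfl | hp
    · rw [Equiv.swap_apply_left, hpq]
    rcases eq_or_ne s q with rfl | hq
    · rw [Equiv.swap_apply_right, hpq]
    · rw [Equiv.swap_apply_of_ne_of_ne hp hq]
  refine ⟨?_, hκ.crossing, hκ.marked⟩
  rintro ⟨s, _ | _⟩
  · have := key (L.next.symm s)
    rw [Equiv.apply_symm_apply] at this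
    simp [Diagram.across, this]
  · exact key s

/-- As at a crossing, but the transposition now alters `across`, so the relevant halves should be
coloured `false`. -/
lemma surgery_saddle {K L : Diagram n m} {p q : Strand n m} (hne : p ≠ q)
    (hpos : L.positive = K.positive) (hs : L.next = K.next * Equiv.swap p q)
    {κ : HalfEdge n m → Bool} (hκ : IsAlternating K κ) (hpq : κ (p, true) = κ (q, true))
    (v : Fin n → Bool) :
    Surgery (fun x y => Conn (K.Joined v) (K.edge x) (K.edge y))
      (fun x y => Conn (L.Joined v) (L.edge x) (L.edge y)) (p, true) (q, true) := by
  wlog h0 : κ (p, true) = false generalizing κ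
  · exact this hκ.not (by simpa using hpq) (by simpa using h0)
  have hκL := hκ.of_saddle hs hpq
  have h1 : κ (q, true) = false := hpq ▸ h0
  have hperm : hκL.perm v = hκ.perm v * Equiv.swap (p, true) (q, true) := by
    ext1 h
    rw [Equiv.Perm.mul_apply]
    have hj : L.joint v h = K.joint v h := by
      rcases h with ⟨⟨c', o⟩ | a, b⟩ <;> simp [joint, hpos]
    rcases eq_or_ne h (p, true) with rfl | hp
    · simp [IsAlternating.perm_apply, h0, h1, across, hs]
    rcases eq_or_ne h (q, true) with rfl | hq
    · simp [IsAlternating.perm_apply, h0, h1, across, hs]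
    rw [Equiv.swap_apply_of_ne_of_ne hp hq, IsAlternating.perm_apply, IsAlternating.perm_apply, hj]
    split_ifs with hh
    · rfl
    · rcases h with ⟨s, _ | _⟩
      · have hinv : L.next.symm s = Equiv.swap p q (K.next.symm s) := by
          rw [Equiv.symm_apply_eq, hs]
          simp
        have hc : κ (K.next.symm s, true) = true := by
          have := hκ.across (s, false)
          simp only [across] at this
          rw [this]
          simpa using hh
        simp only [across, hinv]
        rw [Equiv.swap_apply_of_ne_of_ne]
        · rintro h; rw [h, h0] at hc; simp at hc
        · rintro h; rw [h, h1] at hc; simp at hc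
      · simp only [across, hs, Equiv.Perm.mul_apply]
        rw [Equiv.swap_apply_of_ne_of_ne (by rintro rfl; exact hp rfl) (by rintro rfl; exact hq rfl)]
  simp only [hκ.conn_iff, hκL.conn_iff, hperm]
  exact surgery_mul_swap _ (by simpa using hne)

/-- After a merge the two points share a circle; after a split both actions come from the one circle
before. -/
lemma factor_mul_eq_of_surgery {E : Type} [Finite E] {r r' : E → E → Prop} {i k : E}
    (h : Surgery (Conn r) (Conn r') i k) (x : A) (y : CircleAlg r) :
    factor r' i x * saddleMap r r' i k y = factor r' k x * saddleMap r r' i k y := by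
  rcases h with h' | h'
  · rw [factor_congr (h'.joins (conn_equivalence r))]
  · rw [← saddleMap_factor_mul (.inr h'), ← saddleMap_factor_mul (.inr h'),
      factor_congr (h'.joins (conn_equivalence r'))]

/-- The map of a saddle between two diagrams in a fixed resolution. -/
lemma isSaddle_saddle {K L : Diagram n m} {p q : Strand n m} (hne : p ≠ q)
    (hpos : L.positive = K.positive) (hs : L.next = K.next * Equiv.swap p q)
    {κ : HalfEdge n m → Bool} (hκ : IsAlternating K κ) (hpq : κ (p, true) = κ (q, true))
    (v : Fin n → Bool) :
    IsSaddle (K.Joined v) (L.Joined v) K.edge L.edge (p, true) (q, true)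
      (saddleMap (K.Joined v) (L.Joined v) p q) := by
  have hsur := surgery_saddle hne hpos hs hκ hpq v
  have hsur' : Surgery (Conn (K.Joined v)) (Conn (L.Joined v)) p q :=
    hsur.imp (fun h => ⟨h.1, fun x y => h.2 (x, true) (y, true)⟩)
      (fun h => ⟨h.1, fun x y => h.2 (x, true) (y, true)⟩)
  refine ⟨hsur, fun h x y => ?_, saddleMap_one_of_conn, saddleMap_one_of_not_conn⟩
  rw [saddleMap_factor_mul hsur']
  rcases h with ⟨s, _ | _⟩
  -- Edges are named by the strand they leave, so the saddle exchanges the names `p` and `q` at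
  -- incoming half-edges.
  · have hinv : L.edge (s, false) = Equiv.swap p q (K.edge (s, false)) := by
      simp only [edge, inEdge]
      rw [Equiv.symm_apply_eq, hs]
      simp
    rw [hinv]
    rcases eq_or_ne (K.edge (s, false)) p with h | hp
    · rw [h, Equiv.swap_apply_left, factor_mul_eq_of_surgery hsur']
    rcases eq_or_ne (K.edge (s, false)) q with h | hq
    · rw [h, Equiv.swap_apply_right, factor_mul_eq_of_surgery hsur']
    · rw [Equiv.swap_apply_of_ne_of_ne hp hq]
  · rfl

/-! ### Signs in the cube -/

lemma cubeSign_mul_self (w : Fin n → Bool) (c : Fin n) : cubeSign w c * cubeSign w c = 1 := by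
  rw [cubeSign, ← pow_add, ← two_mul, pow_mul]
  simp

lemma cubeSign_update_of_not_lt {c c' : Fin n} (h : ¬ c < c') (w : Fin n → Bool) (b : Bool) :
    cubeSign (Function.update w c b) c' = cubeSign w c' := by
  unfold cubeSign
  congr 2
  ext d
  by_cases hd : d = c
  · subst hd; simp [h]
  · simp [hd]

lemma cubeSign_update_of_lt {c c' : Fin n} (h : c < c') {w : Fin n → Bool} (hw : w c = true) :
    cubeSign (Function.update w c false) c' = - cubeSign w c' := by
  unfold cubeSign
  have : (Finset.univ.filter fun d => d < c' ∧ w d = true) =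
      insert c (Finset.univ.filter fun d => d < c' ∧ Function.update w c false d = true) := by
    ext d
    by_cases hd : d = c
    · subst hd; simp [h, hw]
    · simp [hd]
  rw [this, Finset.card_insert_of_notMem (by simp), pow_succ]
  simp

/-- Exactly one of the two signs changes, so every square of the cube anticommutes. -/
lemma cubeSign_update_cases {c c' : Fin n} (h : c ≠ c') {w : Fin n → Bool} (hc : w c = true)
    (hc' : w c' = true) :
    (cubeSign (Function.update w c false) c' = - cubeSign w c' ∧
      cubeSign (Function.update w c' false) c = cubeSign w c) ∨
    (cubeSign (Function.update w c false) c' = cubeSign w c' ∧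
      cubeSign (Function.update w c' false) c = - cubeSign w c) := by
  rcases h.lt_or_gt with h | h
  · exact .inl ⟨cubeSign_update_of_lt h hc, cubeSign_update_of_not_lt h.not_gt _ _⟩
  · exact .inr ⟨cubeSign_update_of_not_lt h.not_gt _ _, cubeSign_update_of_lt h hc'⟩

/-! ### The differential -/

/-- The saddle map at the crossing `c` between two resolutions. -/
def crossMap (K : Diagram n m) (c : Fin n) (v w : Fin n → Bool) :
    CircleAlg (K.Joined v) →ₗ[R] CircleAlg (K.Joined w) :=
  saddleMap (K.Joined v) (K.Joined w) (K.ends c 0).1 (K.ends c 2).1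

lemma d_apply (K : Diagram n m) (x : K.Chain) (w : Fin n → Bool) :
    K.d x w = ∑ c : Fin n, if w c = true then
      cubeSign w c • K.crossMap c (Function.update w c false) w (x (Function.update w c false))
      else 0 := by
  simp only [d, LinearMap.pi_apply, LinearMap.sum_apply]
  refine Finset.sum_congr rfl fun c _ => ?_
  split_ifs <;> rfl

variable {K : Diagram n m} {κ : HalfEdge n m → Bool}

lemma crossMap_comm (hκ : IsAlternating K κ) {c c' : Fin n} {r s t u : Fin n → Bool}
    (hs : Flip c r s) (hu : Flip c' s u) (ht : Flip c' r t) (hu' : Flip c t u)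
    (x : CircleAlg (K.Joined r)) :
    K.crossMap c' s u (K.crossMap c r s x) = K.crossMap c t u (K.crossMap c' r t x) :=
  LinearMap.congr_fun (IsSaddle.comm K.edge_surjective (isSaddle_crossing hκ hs)
    (isSaddle_crossing hκ hu) (isSaddle_crossing hκ ht) (isSaddle_crossing hκ hu')) x

lemma crossMap_reverse (hκ : IsAlternating K κ) {c : Fin n} {v w : Fin n → Bool}
    (h : Flip c v w) (h' : Flip c w v) (x : CircleAlg (K.Joined v)) :
    K.crossMap c w v (K.crossMap c v w x) =
      dotPair (K.Joined v) (K.edge (.inl (c, false), false)) (K.edge (.inl (c, false), true)) *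
        x :=
  LinearMap.congr_fun (IsSaddle.comp_reverse K.edge_surjective (isSaddle_crossing hκ h)
    (isSaddle_crossing hκ h')) x

lemma d_comp_d (hκ : IsAlternating K κ) : K.d ∘ₗ K.d = 0 := by
  refine LinearMap.ext fun x => funext fun w => ?_
  simp only [LinearMap.comp_apply, LinearMap.zero_apply, Pi.zero_apply]
  rw [d_apply]
  -- The contribution of the path that reaches `w` by changing `p.2` and then `p.1`; exchanging the
  -- two crossings cancels the terms in pairs.
  let F : Fin n × Fin n → CircleAlg (K.Joined w) := fun p =>
    if w p.1 = true ∧ w p.2 = true ∧ p.2 ≠ p.1 then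
      (cubeSign w p.1 * cubeSign (Function.update w p.1 false) p.2) •
        K.crossMap p.1 (Function.update w p.1 false) w
          (K.crossMap p.2 (Function.update (Function.update w p.1 false) p.2 false)
            (Function.update w p.1 false)
            (x (Function.update (Function.update w p.1 false) p.2 false)))
    else 0
  have hF : ∀ c, (if w c = true then cubeSign w c • K.crossMap c (Function.update w c false) w
      (K.d x (Function.update w c false)) else 0) = ∑ c', F (c, c') := by
    intro c
    split_ifs with hc
    · rw [d_apply, map_sum, Finset.smul_sum]
      refine Finset.sum_congr rfl fun c' _ => ?_
      by_cases hcc : c' = c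
      · subst hcc; simp [F]
      · rw [Function.update_of_ne hcc]
        by_cases hc' : w c' = true
        · simp only [F, hc, hc', hcc, ne_eq, not_false_eq_true, and_self, if_true, map_zsmul,
            mul_smul]
        · simp [F, hc']
    · simp [F, hc]
  simp only [hF]
  rw [← Fintype.sum_prod_type' fun c c' => F (c, c')]
  refine Finset.sum_ninvolution Prod.swap ?_ ?_ (fun _ => Finset.mem_univ _) (fun _ => rfl)
  · rintro ⟨c, c'⟩
    simp only [Prod.swap, F]
    by_cases h : w c = true ∧ w c' = true ∧ c' ≠ c
    · obtain ⟨hc, hc', hcc⟩ := h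
      rw [if_pos ⟨hc, hc', hcc⟩, if_pos ⟨hc', hc, hcc.symm⟩]
      rw [Function.update_comm hcc false false w,
        crossMap_comm hκ (t := Function.update w c' false), ← add_smul]
      · rcases cubeSign_update_cases hcc.symm hc hc' with h | h <;> rw [h.1, h.2] <;>
        convert zero_smul ℤ _ <;> ring
      all_goals
        simp only [Flip, Function.update_apply]
        grind
    · rw [if_neg h, if_neg (by tauto), add_zero]
  · rintro ⟨c, c'⟩ h h'
    obtain rfl : c' = c := congrArg Prod.fst h'
    simp [F] at h

/-! ### Chain maps -/

lemma isChainMap_mulAt (hκ : IsAlternating K κ) (a : A) (e : Strand n m) :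
    IsChainMap (K.mulAt a e) := by
  refine LinearMap.ext fun x => funext fun w => ?_
  simp only [LinearMap.comp_apply, mulAt, LinearMap.pi_apply, LinearMap.proj_apply,
    LinearMap.mulLeft_apply, d_apply, Finset.mul_sum]
  refine Finset.sum_congr rfl fun c _ => ?_
  split_ifs with hc
  · rw [mul_smul_comm]
    congr 1
    exact (isSaddle_crossing hκ (by simp only [Flip, Function.update_apply]; grind)).map_factor_mul
      (e, true) a _
  · rw [mul_zero]

/-- The saddle commutes with each crossing saddle, and the cube signs are the same for both
diagrams. -/
lemma isChainMap_saddle {K L : Diagram n m} {p q : Strand n m} (hne : p ≠ q)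
    (hpos : L.positive = K.positive) (hs : L.next = K.next * Equiv.swap p q)
    {κ : HalfEdge n m → Bool} (hκ : IsAlternating K κ) (hpq : κ (p, true) = κ (q, true)) :
    IsChainMap (saddleChainMap K L p q) := by
  refine LinearMap.ext fun x => funext fun w => ?_
  simp only [LinearMap.comp_apply, saddleChainMap, LinearMap.pi_apply, LinearMap.proj_apply,
    d_apply, map_sum]
  refine Finset.sum_congr rfl fun c _ => ?_
  split_ifs with hc
  · rw [map_zsmul]
    congr 1
    have hf : Flip c (Function.update w c false) w := by
      simp only [Flip, Function.update_apply]; grind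
    exact LinearMap.congr_fun (IsSaddle.comm K.edge_surjective
      (isSaddle_saddle hne hpos hs hκ hpq (Function.update w c false))
      (isSaddle_crossing (hκ.of_saddle hs hpq) hf) (isSaddle_crossing hκ hf)
      (isSaddle_saddle hne hpos hs hκ hpq w)) _
  · rw [map_zero]

/-! ### Null-homotopic maps -/

/-- The maps that are chain homotopic to `0`. -/
def nullHomotopic (K : Diagram n m) : AddSubgroup (K.Chain →ₗ[R] K.Chain) where
  carrier := {φ | ∃ h : K.Chain →ₗ[R] K.Chain,
    (∀ (v w : Fin n → Bool) (x : CircleAlg (K.Joined v)),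
      h (Pi.single v x) w ≠ 0 → weight w + 1 = weight v) ∧ φ = K.d ∘ₗ h + h ∘ₗ K.d}
  zero_mem' := ⟨0, by simp, by simp⟩
  add_mem' := by
    rintro φ ψ ⟨h, hd, rfl⟩ ⟨h', hd', rfl⟩
    refine ⟨h + h', fun v w x hx => ?_, ?_⟩
    · by_cases h0 : h (Pi.single v x) w = 0
      · refine hd' v w x fun h0' => hx ?_
        rw [LinearMap.add_apply, Pi.add_apply, h0, h0', add_zero]
      · exact hd v w x h0
    · rw [LinearMap.comp_add, LinearMap.add_comp]
      abel
  neg_mem' := by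
    rintro φ ⟨h, hd, rfl⟩
    refine ⟨-h, fun v w x hx => hd v w x fun h0 => hx ?_, ?_⟩
    · rw [LinearMap.neg_apply, Pi.neg_apply, h0, neg_zero]
    · rw [LinearMap.comp_neg, LinearMap.neg_comp, neg_add]

lemma homotopic_iff {φ ψ : K.Chain →ₗ[R] K.Chain} :
    Homotopic φ ψ ↔ φ - ψ ∈ K.nullHomotopic := Iff.rfl

/-- The homotopy given by the reverse saddle at a crossing. -/
def reverseSaddle (K : Diagram n m) (c : Fin n) : K.Chain →ₗ[R] K.Chain :=
  LinearMap.pi fun w => if w c = false then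
    cubeSign w c • (K.crossMap c (Function.update w c true) w ∘ₗ
      LinearMap.proj (Function.update w c true)) else 0

lemma reverseSaddle_apply (K : Diagram n m) (c : Fin n) (x : K.Chain) (w : Fin n → Bool) :
    K.reverseSaddle c x w = if w c = false then
      cubeSign w c • K.crossMap c (Function.update w c true) w (x (Function.update w c true))
      else 0 := by
  simp only [reverseSaddle, LinearMap.pi_apply]
  split_ifs <;> rfl

lemma weight_update {w : Fin n → Bool} {c : Fin n} (h : w c = false) :
    weight (Function.update w c true) = weight w + 1 := by
  unfold weight
  have : (Finset.univ.filter fun d => Function.update w c true d = true) =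
      insert c (Finset.univ.filter fun d => w d = true) := by
    ext d
    by_cases hd : d = c
    · subst hd; simp
    · simp [hd]
  rw [this, Finset.card_insert_of_notMem (by simp [h])]

lemma reverseSaddle_degree (K : Diagram n m) (c : Fin n) (v w : Fin n → Bool)
    (x : CircleAlg (K.Joined v)) (h : K.reverseSaddle c (Pi.single v x) w ≠ 0) :
    weight w + 1 = weight v := by
  rw [reverseSaddle_apply] at h
  split_ifs at h with hc
  · by_cases hv : Function.update w c true = v
    · rw [← hv, weight_update hc]
    · rw [Pi.single_eq_of_ne hv, map_zero, smul_zero] at h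
      exact absurd rfl h
  · exact absurd rfl h

/-- The map given by `dot₁ + dot₂` on the two sides of a crossing. -/
def crossingDots (K : Diagram n m) (c : Fin n) : K.Chain →ₗ[R] K.Chain :=
  LinearMap.pi fun v => LinearMap.mulLeft R (dotPair (K.Joined v)
    (K.edge (.inl (c, false), false)) (K.edge (.inl (c, false), true))) ∘ₗ LinearMap.proj v

/-- The terms in direction `c` give a saddle followed by its reverse, with sign squared. Terms in
any other direction vanish or cancel by anticommutativity. -/
lemma crossingDots_eq (hκ : IsAlternating K κ) (c : Fin n) :
    K.crossingDots c = K.d ∘ₗ K.reverseSaddle c + K.reverseSaddle c ∘ₗ K.d := by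
  refine LinearMap.ext fun x => funext fun w => ?_
  simp only [LinearMap.add_apply, LinearMap.comp_apply, Pi.add_apply, crossingDots,
    LinearMap.pi_apply, LinearMap.proj_apply, LinearMap.mulLeft_apply]
  rw [d_apply, reverseSaddle_apply]
  -- When `w c` is `false` the `c`-term comes from `h ∘ d`; when it is `true`, `h ∘ d` vanishes at
  -- `w` and the `c`-term comes from `d ∘ h`.
  cases hc : w c
  · rw [if_pos rfl, d_apply, map_sum, Finset.smul_sum, ← Finset.sum_add_distrib,
      Finset.sum_eq_single c]
    · have hw : Function.update (Function.update w c true) c false = w := by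
        rw [Function.update_idem, ← hc, Function.update_eq_self]
      rw [hc, if_neg Bool.false_ne_true, zero_add, Function.update_self, if_pos rfl,
        cubeSign_update_of_not_lt (lt_irrefl c), hw, map_zsmul, ← mul_smul, cubeSign_mul_self,
        one_smul, crossMap_reverse hκ]
      all_goals
        simp only [Flip, Function.update_apply]
        grind
    · intro c' _ hcc
      rw [Function.update_of_ne hcc]
      split_ifs with hc'
      · rw [reverseSaddle_apply, Function.update_of_ne hcc.symm, if_pos hc, map_zsmul, map_zsmul,
          ← mul_smul, ← mul_smul, Function.update_comm hcc.symm,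
          crossMap_comm hκ (t := Function.update w c true), ← add_smul]
        · convert zero_smul ℤ _
          rcases hcc.lt_or_gt with h | h
          · rw [cubeSign_update_of_lt h hc', cubeSign_update_of_not_lt h.not_gt]
            ring
          · have hw : w = Function.update (Function.update w c true) c false := by
              rw [Function.update_idem, ← hc, Function.update_eq_self]
            have hs := cubeSign_update_of_lt h (w := Function.update w c true) (by simp)
            rw [← hw] at hs
            rw [hs, cubeSign_update_of_not_lt h.not_gt]
            ring
        all_goals
          simp only [Flip, Function.update_apply]
          grind
      · rw [map_zero, smul_zero, add_zero]
    · simp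
  · rw [if_neg (by simp), add_zero, Finset.sum_eq_single c]
    · have hw : Function.update (Function.update w c false) c true = w := by
        rw [Function.update_idem, ← hc, Function.update_eq_self]
      rw [if_pos hc, reverseSaddle_apply, Function.update_self, if_pos rfl,
        cubeSign_update_of_not_lt (lt_irrefl c), hw, map_zsmul, ← mul_smul, cubeSign_mul_self,
        one_smul, crossMap_reverse hκ]
      all_goals
        simp only [Flip, Function.update_apply]
        grind
    · intro c' _ hcc
      rw [reverseSaddle_apply, Function.update_of_ne hcc.symm, hc]
      simp
    · simp

lemma crossingDots_mem (hκ : IsAlternating K κ) (c : Fin n) :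
    K.crossingDots c ∈ K.nullHomotopic :=
  ⟨K.reverseSaddle c, K.reverseSaddle_degree c, crossingDots_eq hκ c⟩

/-! ### Moving points along a component -/

/-- The smoothing joins the two under-halves to the two over-halves in some order, and `dotPair` is
symmetric; hence one homotopy serves both strands. -/
lemma crossingDots_eq_mulAt (c : Fin n) (o : Bool) :
    K.crossingDots c = K.mulAt X (K.inEdge (.inl (c, o))) + K.mulAt X (.inl (c, o)) -
      (α₁ + α₂) • LinearMap.id := by
  refine LinearMap.ext fun x => funext fun v => ?_
  have h : dotPair (K.Joined v) (K.edge (.inl (c, false), false)) (K.edge (.inl (c, false), true)) =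
      dotPair (K.Joined v) (K.edge (.inl (c, o), false)) (K.edge (.inl (c, o), true)) := by
    cases o
    · rfl
    · have h₁ := K.conn_edge_joint v (.inl (c, false), false)
      have h₂ := K.conn_edge_joint v (.inl (c, false), true)
      rw [dotPair_congr h₁ h₂]
      cases hb : (K.positive c ^^ v c) <;> simp only [joint, hb]
      · rfl
      · exact dotPair_comm _ _ _
  calc dotPair (K.Joined v) (K.edge (.inl (c, false), false)) (K.edge (.inl (c, false), true)) * x v
      = factor (K.Joined v) (K.inEdge (.inl (c, o))) X * x v +
          factor (K.Joined v) (.inl (c, o)) X * x v - (α₁ + α₂) • x v := by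
        rw [h, dotPair_eq, sub_mul, add_mul, ← Algebra.smul_def]
        rfl
    _ = _ := rfl

lemma mulAt_marked (a : A) (b : Fin m) :
    K.mulAt a (K.inEdge (.inr b)) = K.mulAt a (.inr b) := by
  refine LinearMap.ext fun x => funext fun v => ?_
  simp only [mulAt, LinearMap.pi_apply, LinearMap.comp_apply]
  rw [factor_congr (Quot.sound (Joined.marked b))]
  rfl

/-- In this form `X ↦ α₁ + α₂ - X` visibly changes the sign. -/
lemma mulAt_Xstar (e : Strand n m) :
    K.mulAt Xstar e = (2 : ℤ) • K.mulAt X e - (α₁ + α₂) • LinearMap.id := by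
  have : Xstar = X + X - algebraMap R A (α₁ + α₂) := by
    simp only [Xstar, dot₁, dot₂, map_add]; ring
  refine LinearMap.ext fun x => funext fun v => ?_
  calc factor (K.Joined v) e Xstar * x v
      = (2 : ℤ) • (factor (K.Joined v) e X * x v) - (α₁ + α₂) • x v := by
        rw [this, map_sub, map_add, AlgHom.commutes, sub_mul, add_mul, ← Algebra.smul_def, two_smul]
    _ = _ := rfl

/-- The endomorphisms `X` at two points of a component are homotopic, or homotopic up to the
involution `X ↦ α₁ + α₂ - X`, according to the colours. -/
lemma mulAt_X_of_sameComponent (hκ : IsAlternating K κ) {p e : Strand n m}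
    (h : K.SameComponent p e) :
    (κ (e, true) = κ (p, true) ∧ K.mulAt X e - K.mulAt X p ∈ K.nullHomotopic) ∨
    (κ (e, true) = (!κ (p, true)) ∧
      K.mulAt X e + K.mulAt X p - (α₁ + α₂) • LinearMap.id ∈ K.nullHomotopic) := by
  obtain ⟨k, rfl⟩ := Equiv.Perm.SameCycle.exists_nat_pow_eq h
  clear h
  induction k with
  | zero => left; simp [zero_mem]
  | succ k ih =>
    rw [pow_succ', Equiv.Perm.mul_apply]
    generalize (K.next ^ k) p = e at ih
    have he : K.inEdge (K.next e) = e := by simp [inEdge]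
    have hk : κ (K.next e, false) = !κ (e, true) := hκ.across (e, true)
    generalize K.next e = s at he hk
    rcases s with ⟨c, o⟩ | a
    · have hd := K.crossingDots_eq_mulAt c o ▸ crossingDots_mem hκ c
      rw [he] at hd
      -- The colour is constant through a crossing but changes along an edge, so consecutive edges
      -- differ in colour here.
      have hk' : κ (.inl (c, o), true) = κ (.inl (c, o), false) := by
        cases o
        · have := hκ.crossing c true true
          rw [hκ.crossing c true false] at this
          simpa using this.symm
        · rw [hκ.crossing c true true, hκ.crossing c false true]
      rw [hk', hk]
      rcases ih with ⟨h₁, h₂⟩ | ⟨h₁, h₂⟩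
      · right
        refine ⟨by rw [h₁], ?_⟩
        convert sub_mem hd h₂ using 1
        abel
      · left
        refine ⟨by rw [h₁, Bool.not_not], ?_⟩
        convert sub_mem hd h₂ using 1
        abel
    · have hk' : κ (.inr a, true) = κ (e, true) := by rw [hκ.marked, hk, Bool.not_not]
      rw [hk', ← mulAt_marked, he]
      exact ih


/-! ### Checkerboard colourings of planar diagrams -/

/-- The face on a side of an edge. -/
def faceAt (K : Diagram n m) (s : Strand n m) (b : Bool) : K.Face := Quot.mk _ (s, b)

lemma faceAt_marked (K : Diagram n m) (a : Fin m) (b : Bool) :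
    K.faceAt (K.inEdge (.inr a)) b = K.faceAt (.inr a) b := Quot.sound (.marked a b)

lemma faceAt_crossing_positive (K : Diagram n m) {c : Fin n} (h : K.positive c = true) :
    K.faceAt (K.inEdge (.inl (c, false))) false = K.faceAt (.inl (c, true)) false ∧
    K.faceAt (.inl (c, true)) true = K.faceAt (.inl (c, false)) false ∧
    K.faceAt (.inl (c, false)) true = K.faceAt (K.inEdge (.inl (c, true))) true ∧
    K.faceAt (K.inEdge (.inl (c, true))) false = K.faceAt (K.inEdge (.inl (c, false))) true := by
  have key : ∀ i, K.faceAt (K.ends c i).1 (K.ends c i).2 =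
    K.faceAt (K.ends c (i + 1)).1 !(K.ends c (i + 1)).2 := fun i => Quot.sound (.crossing c i)
  have h0 := key 0
  have h1 := key 1
  have h2 := key 2
  have h3 := key 3
  simp [ends, h, outEdge] at h0 h1 h2 h3
  exact ⟨h0, h1, h2, h3⟩

lemma faceAt_crossing_negative (K : Diagram n m) {c : Fin n} (h : K.positive c = false) :
    K.faceAt (K.inEdge (.inl (c, false))) false = K.faceAt (K.inEdge (.inl (c, true))) true ∧
    K.faceAt (K.inEdge (.inl (c, true))) false = K.faceAt (.inl (c, false)) false ∧
    K.faceAt (.inl (c, false)) true = K.faceAt (.inl (c, true)) false ∧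
    K.faceAt (.inl (c, true)) true = K.faceAt (K.inEdge (.inl (c, false))) true := by
  have key : ∀ i, K.faceAt (K.ends c i).1 (K.ends c i).2 =
    K.faceAt (K.ends c (i + 1)).1 !(K.ends c (i + 1)).2 := fun i => Quot.sound (.crossing c i)
  have h0 := key 0
  have h1 := key 1
  have h2 := key 2
  have h3 := key 3
  simp [ends, h, outEdge] at h0 h1 h2 h3
  exact ⟨h0, h1, h2, h3⟩

/-! ### Homology modulo `2` and Euler's formula -/

/-- The coboundary of a cochain on the vertices, modulo `2`. -/
def vertexCoboundary (K : Diagram n m) :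
    (Fin n ⊕ Fin m → ZMod 2) →ₗ[ZMod 2] (Strand n m → ZMod 2) :=
  LinearMap.funLeft (ZMod 2) (ZMod 2) vertex +
    LinearMap.funLeft (ZMod 2) (ZMod 2) fun s => vertex (K.next s)

/-- The boundary of a chain of faces, modulo `2`. -/
def faceBoundary (K : Diagram n m) : (K.Face → ZMod 2) →ₗ[ZMod 2] (Strand n m → ZMod 2) :=
  LinearMap.funLeft (ZMod 2) (ZMod 2) (K.faceAt · true) +
    LinearMap.funLeft (ZMod 2) (ZMod 2) (K.faceAt · false)

lemma faceBoundary_apply (K : Diagram n m) (f : K.Face → ZMod 2) (s : Strand n m) :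
    K.faceBoundary f s = f (K.faceAt s true) + f (K.faceAt s false) := rfl

lemma zmod_two_eq_of_add_eq_zero {a b : ZMod 2} (h : a + b = 0) : a = b := by
  revert a b; decide

instance (K : Diagram n m) : Finite K.Piece := Quot.finite _

instance (K : Diagram n m) : Finite K.Face := Quot.finite _

/-- A cocycle is constant on each piece, so its values at representatives determine it. -/
lemma finrank_ker_vertexCoboundary_le (K : Diagram n m) :
    Module.finrank (ZMod 2) (LinearMap.ker K.vertexCoboundary) ≤ Nat.card K.Piece := by
  have := Fintype.ofFinite K.Piece
  rw [Nat.card_eq_fintype_card, ← Module.finrank_fintype_fun_eq_card (ZMod 2)]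
  refine LinearMap.finrank_le_finrank_of_injective (f :=
    LinearMap.funLeft (ZMod 2) (ZMod 2) (fun P : K.Piece => P.out) ∘ₗ Submodule.subtype _) ?_
  rw [← LinearMap.ker_eq_bot, LinearMap.ker_eq_bot']
  rintro ⟨g, hg⟩ h0
  ext x
  let G : K.Piece → ZMod 2 := Quot.lift g (by
    rintro _ _ ⟨s, rfl, rfl⟩
    exact zmod_two_eq_of_add_eq_zero (congrFun (LinearMap.mem_ker.1 hg) s))
  have h1 : G (Quot.mk _ (Quot.mk _ x : K.Piece).out) = 0 := congrFun h0 (Quot.mk _ x)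
  rw [Quot.out_eq] at h1
  exact h1

/-- A strand at each vertex. -/
def strandAt : Fin n ⊕ Fin m → Strand n m := Sum.map (·, false) id

/-- A chain without boundary agrees on both sides of every edge, hence around every vertex and
throughout each piece. -/
lemma finrank_ker_faceBoundary_le (K : Diagram n m) :
    Module.finrank (ZMod 2) (LinearMap.ker K.faceBoundary) ≤ Nat.card K.Piece := by
  have := Fintype.ofFinite K.Piece
  rw [Nat.card_eq_fintype_card, ← Module.finrank_fintype_fun_eq_card (ZMod 2)]
  refine LinearMap.finrank_le_finrank_of_injective (f :=
    LinearMap.funLeft (ZMod 2) (ZMod 2) (fun P : K.Piece => K.faceAt (strandAt P.out) true) ∘ₗ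
      Submodule.subtype _) ?_
  rw [← LinearMap.ker_eq_bot, LinearMap.ker_eq_bot']
  rintro ⟨f, hf⟩ h0
  have hside : ∀ s, f (K.faceAt s false) = f (K.faceAt s true) := fun s =>
    (zmod_two_eq_of_add_eq_zero (congrFun (LinearMap.mem_ker.1 hf) s)).symm
  have hcross : ∀ c, f (K.faceAt (.inl (c, true)) true) = f (K.faceAt (.inl (c, false)) true) ∧
      ∀ o, f (K.faceAt (K.inEdge (.inl (c, o))) true) = f (K.faceAt (.inl (c, false)) true) := by
    intro c
    cases hc : K.positive c
    · obtain ⟨h0, h1, h2, h3⟩ := K.faceAt_crossing_negative hc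
      replace h0 := congrArg f h0
      replace h1 := congrArg f h1
      replace h2 := congrArg f h2
      replace h3 := congrArg f h3
      simp only [hside] at h0 h1 h2 h3
      refine ⟨h2.symm, fun o => ?_⟩
      cases o
      · rw [h0, h1]
      · exact h1
    · obtain ⟨h0, h1, h2, h3⟩ := K.faceAt_crossing_positive hc
      replace h0 := congrArg f h0
      replace h1 := congrArg f h1
      replace h2 := congrArg f h2
      replace h3 := congrArg f h3
      simp only [hside] at h0 h1 h2 h3
      refine ⟨h1, fun o => ?_⟩
      cases o
      · rw [h0, h1]
      · exact h2.symm
  have hvertex : ∀ s, f (K.faceAt s true) = f (K.faceAt (strandAt (vertex s)) true) := by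
    rintro (⟨c, _ | _⟩ | a)
    · rfl
    · exact (hcross c).1
    · rfl
  have hin : ∀ s, f (K.faceAt (K.inEdge s) true) = f (K.faceAt (strandAt (vertex s)) true) := by
    rintro (⟨c, o⟩ | a)
    · exact (hcross c).2 o
    · rw [faceAt_marked]
      rfl
  let G : K.Piece → ZMod 2 := Quot.lift (fun x => f (K.faceAt (strandAt x) true)) (by
    rintro _ _ ⟨s, rfl, rfl⟩
    rw [← hvertex, ← hin, inEdge, Equiv.symm_apply_apply])
  have hzero : ∀ s, f (K.faceAt s true) = 0 := by
    intro s
    have h1 : G (Quot.mk _ (Quot.mk _ (vertex s) : K.Piece).out) = 0 :=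
      congrFun h0 (Quot.mk _ (vertex s))
    rw [Quot.out_eq] at h1
    exact (hvertex s).trans h1
  ext x
  obtain ⟨⟨s, _ | _⟩, rfl⟩ := Quot.exists_rep x
  · exact (hside s).trans (hzero s)
  · exact hzero s

/-- The chains orthogonal to all coboundaries, as the kernel of a map to the dual. -/
def cycleMap (K : Diagram n m) :
    (Strand n m → ZMod 2) →ₗ[ZMod 2] Module.Dual (ZMod 2) (Fin n ⊕ Fin m → ZMod 2) :=
  K.vertexCoboundary.dualMap ∘ₗ (dotProductEquiv (ZMod 2) (Strand n m)).toLinearMap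

lemma cycleMap_apply (K : Diagram n m) (x : Strand n m → ZMod 2) (g : Fin n ⊕ Fin m → ZMod 2) :
    K.cycleMap x g = ∑ s, (x s + x (K.inEdge s)) * g (vertex s) := by
  have : K.cycleMap x g = ∑ s, x s * (g (vertex s) + g (vertex (K.next s))) := rfl
  simp only [this, mul_add, add_mul, Finset.sum_add_distrib]
  congr 1
  rw [← Equiv.sum_comp K.next fun s => x (K.inEdge s) * g (vertex s)]
  simp only [inEdge, Equiv.symm_apply_apply]

/-- Rank–nullity for the vertex coboundary and its transpose, which have equal rank. -/
lemma finrank_ker_cycleMap (K : Diagram n m) :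
    Module.finrank (ZMod 2) (LinearMap.ker K.cycleMap) + (n + m) =
      (2 * n + m) + Module.finrank (ZMod 2) (LinearMap.ker K.vertexCoboundary) := by
  have h₁ := LinearMap.finrank_range_add_finrank_ker K.cycleMap
  have h₂ := LinearMap.finrank_range_add_finrank_ker K.vertexCoboundary
  have h₃ := LinearMap.finrank_range_dualMap_eq_finrank_range K.vertexCoboundary
  have h₄ : LinearMap.range K.cycleMap = LinearMap.range K.vertexCoboundary.dualMap :=
    LinearMap.range_comp_of_range_eq_top _ (LinearEquiv.range _)
  rw [Module.finrank_fintype_fun_eq_card] at h₁ h₂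
  rw [h₄, h₃] at h₁
  simp only [Fintype.card_sum, Fintype.card_prod, Fintype.card_fin, Fintype.card_bool] at h₁ h₂
  omega

/-- Around a vertex every corner is counted twice, once for each edge end beside it. -/
lemma range_faceBoundary_le (K : Diagram n m) :
    LinearMap.range K.faceBoundary ≤ LinearMap.ker K.cycleMap := by
  rintro _ ⟨f, rfl⟩
  rw [LinearMap.mem_ker]
  refine LinearMap.ext fun g => ?_
  rw [cycleMap_apply, LinearMap.zero_apply, Fintype.sum_sum_type, Fintype.sum_prod_type]
  rw [Finset.sum_eq_zero fun c _ => ?_, Finset.sum_eq_zero fun a _ => ?_, add_zero]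
  · rw [faceBoundary_apply, faceBoundary_apply, faceAt_marked, faceAt_marked]
    rw [CharTwo.add_self_eq_zero, zero_mul]
  · rw [Fintype.sum_bool]
    simp only [vertex, Sum.map_inl, ← add_mul, faceBoundary_apply]
    refine mul_eq_zero_of_left ?_ _
    cases hc : K.positive c
    · obtain ⟨h0, h1, h2, h3⟩ := K.faceAt_crossing_negative hc
      rw [h0, h1, h2, h3]
      generalize f _ = x, f _ = y, f _ = z, f _ = w
      revert x y z w
      decide
    · obtain ⟨h0, h1, h2, h3⟩ := K.faceAt_crossing_positive hc
      rw [h0, h1, h2, h3]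
      generalize f _ = x, f _ = y, f _ = z, f _ = w
      revert x y z w
      decide

/-- Every vertex has even degree, as each strand brings two edge ends. -/
lemma one_mem_ker_cycleMap (K : Diagram n m) : 1 ∈ LinearMap.ker K.cycleMap := by
  rw [LinearMap.mem_ker]
  refine LinearMap.ext fun g => ?_
  rw [cycleMap_apply]
  refine Finset.sum_eq_zero fun s _ => ?_
  simp only [Pi.one_apply]
  rw [show (1 : ZMod 2) + 1 = 0 from rfl, zero_mul]

/-- The faces of a planar diagram have a checkerboard colouring. -/
lemma IsPlanar.exists_checkerboard {K : Diagram n m} (hK : K.IsPlanar) :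
    ∃ f : K.Face → ZMod 2, ∀ s, f (K.faceAt s true) + f (K.faceAt s false) = 1 := by
  have := Fintype.ofFinite K.Face
  have h₁ := LinearMap.finrank_range_add_finrank_ker K.faceBoundary
  rw [Module.finrank_fintype_fun_eq_card, ← Nat.card_eq_fintype_card] at h₁
  have h₂ := K.finrank_ker_cycleMap
  have h₃ := K.finrank_ker_faceBoundary_le
  have h₄ := K.finrank_ker_vertexCoboundary_le
  unfold IsPlanar at hK
  -- With `P` pieces the range has dimension at least `F - P`, the kernel at most `E - V + P`, and
  -- Euler's formula equates these bounds.
  have h : LinearMap.range K.faceBoundary = LinearMap.ker K.cycleMap :=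
    Submodule.eq_of_le_of_finrank_le K.range_faceBoundary_le (by omega)
  obtain ⟨f, hf⟩ := h.ge K.one_mem_ker_cycleMap
  exact ⟨f, fun s => congrFun hf s⟩

/-- A planar diagram has an alternating colouring of its half-edges, which is the same on
edges that have a face on the same side. -/
lemma IsPlanar.exists_isAlternating {K : Diagram n m} (hK : K.IsPlanar) :
    ∃ κ : HalfEdge n m → Bool, IsAlternating K κ ∧
      ∀ p q b, K.faceAt p b = K.faceAt q b → κ (p, true) = κ (q, true) := by
  obtain ⟨f, hf⟩ := hK.exists_checkerboard
  have hf' : ∀ s, f (K.faceAt s false) = f (K.faceAt s true) + 1 := by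
    intro s
    have := hf s
    revert this
    generalize f (K.faceAt s false) = x
    generalize f (K.faceAt s true) = y
    revert x y
    decide
  -- The colour of the left face. The resulting `κ` orients each edge with the face of colour `1` on
  -- its right.
  let σ : Strand n m → Bool := fun s => decide (f (K.faceAt s true) = 1)
  have hσ : ∀ s, σ s = decide (f (K.faceAt s true) = 1) := fun _ => rfl
  refine ⟨fun h => if h.2 then σ h.1 else !σ (K.inEdge h.1), ⟨?_, ?_, ?_⟩, ?_⟩
  · rintro ⟨s, _ | _⟩
    · simp [across, inEdge]
    · simp [across, inEdge]
  · intro c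
    cases hc : K.positive c
    · obtain ⟨h0, h1, h2, h3⟩ := K.faceAt_crossing_negative hc
      replace h0 := congrArg f h0
      replace h1 := congrArg f h1
      replace h2 := congrArg f h2
      replace h3 := congrArg f h3
      simp only [hf'] at h0 h1 h2 h3
      simp only [hσ]
      generalize f (K.faceAt (K.inEdge (.inl (c, false))) true) = x at *
      generalize f (K.faceAt (K.inEdge (.inl (c, true))) true) = y at *
      generalize f (K.faceAt (.inl (c, false)) true) = z at *
      generalize f (K.faceAt (.inl (c, true)) true) = w at *
      clear hf hf' hσ σ
      revert x y z w
      decide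
    · obtain ⟨h0, h1, h2, h3⟩ := K.faceAt_crossing_positive hc
      replace h0 := congrArg f h0
      replace h1 := congrArg f h1
      replace h2 := congrArg f h2
      replace h3 := congrArg f h3
      simp only [hf'] at h0 h1 h2 h3
      simp only [hσ]
      generalize f (K.faceAt (K.inEdge (.inl (c, false))) true) = x at *
      generalize f (K.faceAt (K.inEdge (.inl (c, true))) true) = y at *
      generalize f (K.faceAt (.inl (c, false)) true) = z at *
      generalize f (K.faceAt (.inl (c, true)) true) = w at *
      clear hf hf' hσ σ
      revert x y z w
      decide
  · intro a
    simp [hσ, faceAt_marked]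
  · intro p q b h
    have h' := congrArg f h
    cases b
    · rw [hf', hf'] at h'
      simp [hσ, add_right_cancel h']
    · simp [hσ, h']

/-! ### The saddle and its reverse -/

variable {L : Diagram n m}

/-- A saddle that increases the number of components splits a component. -/
lemma sameComponent_of_numComponents_lt {p q : Strand n m}
    (hs : L.next = K.next * Equiv.swap p q) (h : K.numComponents < L.numComponents) :
    K.SameComponent p q := by
  by_contra hpq
  have hm := hs ▸ merges_mul_swap_of_not hpq
  have hle : ∀ x y, K.SameComponent x y → L.SameComponent x y := fun x y => hm.le
  have : Finite (Quot K.SameComponent) := Quot.finite _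
  -- If `p` and `q` were on different components, the saddle would only unite components, so those
  -- of `K` would map onto those of `L`.
  refine h.not_ge (Nat.card_le_card_of_surjective (Quot.map id hle) ?_)
  rintro ⟨x⟩
  exact ⟨Quot.mk _ x, rfl⟩

lemma saddleChainMap_comp_reverse {p q : Strand n m} (hne : p ≠ q)
    (hpos : L.positive = K.positive) (hs : L.next = K.next * Equiv.swap p q)
    {κ : HalfEdge n m → Bool} (hκ : IsAlternating K κ) (hpq : κ (p, true) = κ (q, true)) :
    saddleChainMap L K p q ∘ₗ saddleChainMap K L p q =
      K.mulAt X p + K.mulAt X q - (α₁ + α₂) • LinearMap.id := by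
  have hs' : K.next = L.next * Equiv.swap p q := by
    rw [hs, mul_assoc, Equiv.swap_mul_self, mul_one]
  refine LinearMap.ext fun x => funext fun v => ?_
  have h := LinearMap.congr_fun (IsSaddle.comp_reverse K.edge_surjective
    (isSaddle_saddle hne hpos hs hκ hpq v)
    (isSaddle_saddle hne hpos.symm hs' (hκ.of_saddle hs hpq) hpq v)) (x v)
  refine h.trans ?_
  rw [LinearMap.mulLeft_apply, dotPair_eq, sub_mul, add_mul, ← Algebra.smul_def]
  rfl

lemma homotopic_saddle {p q e : Strand n m} (hne : p ≠ q)
    (hpos : L.positive = K.positive) (hs : L.next = K.next * Equiv.swap p q)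
    {κ : HalfEdge n m → Bool} (hκ : IsAlternating K κ) (hpq : κ (p, true) = κ (q, true))
    (hq : K.SameComponent p q) (he : K.SameComponent p e) :
    ∃ ε : ℤˣ, Homotopic (saddleChainMap L K p q ∘ₗ saddleChainMap K L p q)
      ((ε : ℤ) • mulAt K Xstar e) := by
  -- Equal colours of `p` and `q` exclude the alternative with the involution.
  have hq' : K.mulAt X q - K.mulAt X p ∈ K.nullHomotopic := by
    rcases mulAt_X_of_sameComponent hκ hq with h | h
    · exact h.2
    · rw [← hpq] at h
      simp at h
  rcases mulAt_X_of_sameComponent hκ he with ⟨-, h⟩ | ⟨-, h⟩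
  · refine ⟨1, ?_⟩
    rw [homotopic_iff, saddleChainMap_comp_reverse hne hpos hs hκ hpq, mulAt_Xstar]
    -- The difference of the two maps is `(X_q - X_p) - 2 (X_e - X_p)`; in the other case it is
    -- `(X_q - X_p) + 2 (X_e + X_p - (α₁ + α₂))`.
    convert sub_mem hq' (add_mem h h) using 1
    simp only [Units.val_one, one_smul, two_smul]
    abel
  · refine ⟨-1, ?_⟩
    rw [homotopic_iff, saddleChainMap_comp_reverse hne hpos hs hκ hpq, mulAt_Xstar]
    convert add_mem hq' (add_mem h h) using 1
    simp only [Units.val_neg, Units.val_one, neg_smul, one_smul, two_smul]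
    abel

/-- Homotopic maps agree on homology. -/
lemma homologyMap_comp_eq_of_homotopic {f : K.Chain →ₗ[R] L.Chain} {g : L.Chain →ₗ[R] K.Chain}
    {φ : K.Chain →ₗ[R] K.Chain} (hf : IsChainMap f) (hg : IsChainMap g) (hφ : IsChainMap φ)
    {a : ℤ} (h : Homotopic (g ∘ₗ f) (a • φ)) :
    homologyMap g hg ∘ₗ homologyMap f hf = a • homologyMap φ hφ := by
  obtain ⟨s, -, hs⟩ := h
  refine Submodule.linearMap_qext _ (LinearMap.ext fun z => ?_)
  refine (Submodule.Quotient.eq _).2 ?_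
  refine ⟨s z.1, ?_⟩
  have h := LinearMap.congr_fun hs z.1
  have hz : K.d z.1 = 0 := z.2
  rw [LinearMap.add_apply, LinearMap.comp_apply, LinearMap.comp_apply, hz, map_zero, add_zero] at h
  exact h.symm

end Diagram

end AlphaHomology

end

open AlphaHomology AlphaHomology.Diagram in
theorem mainTheorem12 {n m : ℕ} (K L : Diagram n m) (p q : Strand n m)
    (hK : K.IsPlanar) (hsaddle : IsOrientedSaddle K L p q)
    (hcomp : K.numComponents < L.numComponents)
    (e : Strand n m) (he : K.SameComponent p e) :
    K.d ∘ₗ K.d = 0 ∧ L.d ∘ₗ L.d = 0 ∧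
    ∃ (hf : IsChainMap (saddleChainMap K L p q)) (hf' : IsChainMap (saddleChainMap L K p q))
      (hX : IsChainMap (mulAt K Xstar e)) (ε : ℤˣ),
      Homotopic (saddleChainMap L K p q ∘ₗ saddleChainMap K L p q) ((ε : ℤ) • mulAt K Xstar e) ∧
      homologyMap (saddleChainMap L K p q) hf' ∘ₗ homologyMap (saddleChainMap K L p q) hf =
        (ε : ℤ) • homologyMap (mulAt K Xstar e) hX := by
  obtain ⟨hne, ⟨b, hface⟩, hpos, hs⟩ := hsaddle
  obtain ⟨κ, hκ, hκface⟩ := hK.exists_isAlternating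
  have hpq := hκface p q b hface
  have hκL := hκ.of_saddle hs hpq
  have hs' : K.next = L.next * Equiv.swap p q := by
    rw [hs, mul_assoc, Equiv.swap_mul_self, mul_one]
  have hq := sameComponent_of_numComponents_lt hs hcomp
  obtain ⟨ε, hε⟩ := homotopic_saddle hne hpos hs hκ hpq hq he
  exact ⟨d_comp_d hκ, d_comp_d hκL, isChainMap_saddle hne hpos hs hκ hpq,
    isChainMap_saddle hne hpos.symm hs' hκL hpq, isChainMap_mulAt hκ Xstar e, ε, hε,
    homologyMap_comp_eq_of_homotopic _ _ _ hε⟩
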